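/- Let $n=3$, $s\in(0,1)$, $r\in\mathbb R$, and fix constants $\kappa>0$ and $c\in\mathbb R\setminus\{0\}$. Put $\alpha(x,y)=\frac{\sqrt{\kappa}}{\sqrt2}\,\frac{y-x}{|y-x|^{n/2+s+1}}$ for $x,y\in\mathbb R^n$. For functions let $$\mathcal D^*u(x,y)=-(u(y)-u(x))\,\alpha(x,y),\qquad \mathcal C^*w(x,y)=\alpha(x,y)\times(w(y)-w(x)),$$ and for vector-valued $\Psi\in C_c^\infty(\mathbb R^{2n})$ let $$\mathcal D\Psi(x)=\int(\Psi(x,y)+\Psi(y,x))\cdot\alpha(x,y)\,dy,\qquad \mathcal C\Psi(x)=\int\alpha(x,y)\times(\Psi(x,y)+\Psi(y,x))\,dy .$$ For distributions on $\mathbb R^n$, $\mathcal D^*$ and $\mathcal C^*$ are defined by $\langle\mathcal D^*T,\Psi\rangle=\langle T,\mathcal D\Psi\rangle$ and $\langle\mathcal C^*T,\Psi\rangle=\langle T,\mathcal C\Psi\rangle$. For $\rho\in\mathbb R$ let $$H^\rho_{fHd}(\mathbb R^{2n})=\{\mathcal D^*\varphi+\mathcal C^*A:\ \varphi,A\in H^{\rho+s}(\mathbb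 R^n),\ \nabla\cdot A=0\}\subset \mathcal D'(\mathbb R^{2n}),$$ with $H^t(\mathbb R^n)$ the ($L^2$-based) Bessel potential spaces of complex-valued distributions. Let $(\Pi v)(x)=c\int_{\mathbb R^n}|x-y|^{-n/2}\,v(x,y)\,dy$, extended by density (from rapidly decreasing potentials) to operators $\Pi\mathcal C^*:H^t(\mathbb R^n)\to H^{t-s}(\mathbb R^n)$ for $t\in\mathbb R$ and $\Pi:H^\rho_{fHd}(\mathbb R^{2n})\to H^\rho(\mathbb R^n)$, $\Pi(\mathcal D^*\varphi+\mathcal C^*A)=\Pi\mathcal D^*\varphi+\Pi\mathcal C^*A$. On $H^\rho_{fHd}(\mathbb R^{2n})$ the divergence $\mathcal D:H^\rho_{fHd}(\mathbb R^{2n})\to H^{\rho-s}(\mathbb R^n)$ is defined by duality, $\langle\mathcal Dv,\psi\rangle=\int_{\mathbb R^{2n}}v\cdot\mathcal D^*\psi$, when the potentials of $v$ are rapidly decreasing, and by density in the potentials in general. Then the two-point curl $\widetilde{\mathcal C}:=\Pi^{-1}(\Pi\mathcal C^*)\Pi$ is a well-defined linear map $$\widetilde{\mathcal C}:H^r_{fHd}(\mathbb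 R^{2n})\to H^{r-s}_{fHd}(\mathbb R^{2n}),$$ that is, for every $v\in H^r_{fHd}(\mathbb R^{2n})$ there is exactly one $\widetilde{\mathcal C}v\in H^{r-s}_{fHd}(\mathbb R^{2n})$ with $\Pi(\widetilde{\mathcal C}v)=(\Pi\mathcal C^*)(\Pi v)$, and it depends linearly on $v$. Moreover, if $v=\mathcal D^*\varphi+\mathcal C^*A$ with $\varphi,A\in H^{r+s}(\mathbb R^n)$ and $\nabla\cdot A=0$, then $$\widetilde{\mathcal C}v=\mathcal C^*\,\Pi\mathcal C^*A ,$$ so $\widetilde{\mathcal C}$ acts as $\mathcal C^*\Pi$ on the curl part of $v$ and does not depend on the gradient part. In particular $\mathcal D\,\widetilde{\mathcal C}v=0$ for all $v\in H^r_{fHd}(\mathbb R^{2n})$. -/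

import Mathlib

open MeasureTheory TopologicalSpace Filter Topology TemperedDistribution
open scoped SchwartzMap Distributions ContDiff Convolution LineDeriv

namespace FracCurl

/-- One-point space `ℝ³`. -/
abbrev Pt := EuclideanSpace ℝ (Fin 3)

/-- Values of vector fields, with the (complexified) coordinates of `ℝ³`. -/
abbrev Vec := EuclideanSpace ℂ (Fin 3)

/-- The bilinear (not sesquilinear) scalar product. -/
def dot (u v : Vec) : ℂ := ∑ i, u i * v i

/-- The cross product. -/
def cross (u v : Vec) : Vec := WithLp.toLp 2 (crossProduct u.ofLp v.ofLp)

/-- The antisymmetric kernel `α(x,y) = √κ/√2 · (y - x) / |y - x|^{n/2+s+1}`, `n = 3`. The positive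
constant `κ` is the normalising constant `C_{n,s}` of the fractional Laplacian. -/
noncomputable def alpha (κ s : ℝ) (x y : Pt) : Vec :=
  WithLp.toLp 2 fun i =>
    ((√κ / √2 * ((y i - x i) / ‖y - x‖ ^ ((3 : ℝ) / 2 + s + 1)) : ℝ) : ℂ)

/-- `dot` as a continuous bilinear map. -/
noncomputable def dotL : Vec →L[ℂ] Vec →L[ℂ] ℂ :=
  (LinearMap.mk₂ ℂ dot (fun a b c => by simp [dot, add_mul, Finset.sum_add_distrib])
    (fun a b c => by simp [dot, Finset.mul_sum, mul_assoc])
    (fun a b c => by simp [dot, mul_add, Finset.sum_add_distrib])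
    (fun a b c => by simp [dot, Finset.mul_sum, mul_left_comm])).toContinuousBilinearMap

@[simp] theorem dotL_apply (u v : Vec) : dotL u v = dot u v := rfl

/-- `cross` as a continuous bilinear map. -/
noncomputable def crossL : Vec →L[ℂ] Vec →L[ℂ] Vec :=
  (LinearMap.mk₂ ℂ cross (fun a b c => by simp [cross]) (fun a b c => by simp [cross])
    (fun a b c => by simp [cross]) (fun a b c => by simp [cross])).toContinuousBilinearMap

@[simp] theorem crossL_apply (u v : Vec) : crossL u v = cross u v := rfl

theorem norm_alpha_le (κ s : ℝ) (x y : Pt) :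
    ‖alpha κ s x y‖ ≤ (√κ / √2) * ‖y - x‖ ^ (-((3 : ℝ) / 2 + s)) := by
  have h : ‖alpha κ s x y‖ = √κ / √2 * (‖y - x‖ / ‖y - x‖ ^ ((3 : ℝ) / 2 + s + 1)) := by
    rw [EuclideanSpace.norm_eq, ← Real.sqrt_sq (show 0 ≤ √κ / √2 *
      (‖y - x‖ / ‖y - x‖ ^ ((3 : ℝ) / 2 + s + 1)) by positivity)]
    congr 1
    rw [mul_pow, div_pow ‖y - x‖, EuclideanSpace.norm_sq_eq, Finset.sum_div, Finset.mul_sum]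
    refine Finset.sum_congr rfl fun i _ => ?_
    simp only [alpha, Complex.norm_real, Real.norm_eq_abs, sq_abs, PiLp.sub_apply]
    ring
  rw [h]
  gcongr
  rcases (norm_nonneg (y - x)).eq_or_lt with h0 | h0
  · rw [← h0]; simp; positivity
  · rw [Real.rpow_add_one h0.ne', Real.rpow_neg h0.le]
    field_simp; rfl

theorem alpha_locallyIntegrable (κ : ℝ) {s : ℝ} (hs : s < 1) :
    LocallyIntegrable (fun t : Pt => alpha κ s 0 (-t)) := by
  refine locallyIntegrable_of_norm_le_rpow (by simp) (C := √κ / √2) (α := 3 / 2 + s) (by simp; linarith)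
    (Eventually.of_forall fun t => ?_) ?_
  · simpa using norm_alpha_le κ s 0 (-t)
  · refine Measurable.aestronglyMeasurable ?_
    unfold alpha
    fun_prop

/-- Auxiliary form of the nonlocal operators, in the variable `t = x - y`. -/
noncomputable def diagOp {E' F : Type} [NormedAddCommGroup E'] [NormedSpace ℝ E']
    [NormedAddCommGroup F] [NormedSpace ℝ F] (L : Vec →L[ℝ] E' →L[ℝ] F) (f : Pt → Vec)
    (g : Pt × Pt → E') (x : Pt) : F :=
  ∫ t, L (f t) (g (x, x - t))

theorem diagOp_contDiff {E' F : Type} [NormedAddCommGroup E'] [NormedSpace ℝ E']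
    [NormedAddCommGroup F] [NormedSpace ℝ F] (L : Vec →L[ℝ] E' →L[ℝ] F)
    {f : Pt → Vec} (hf : LocallyIntegrable f) {g : Pt × Pt → E'} (hg : ContDiff ℝ ∞ g)
    {K : Set (Pt × Pt)} (hK : IsCompact K) (hgK : ∀ p, p ∉ K → g p = 0) :
    ContDiff ℝ ∞ (diagOp L f g) := by
  rw [← contDiffOn_univ]
  refine contDiffOn_convolution_right_with_param_comp (n := ⊤) (μ := volume) L (v := fun x : Pt => x)
    contDiffOn_id (f := f) (g := fun x y => g (x, y)) isOpen_univ (hK.image continuous_snd) ?_ hf ?_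
  · intro p x _ hx
    exact hgK _ fun h => hx ⟨_, h, rfl⟩
  · exact hg.contDiffOn

theorem diagOp_fderiv {E' F : Type} [NormedAddCommGroup E'] [NormedSpace ℝ E']
    [NormedAddCommGroup F] [NormedSpace ℝ F] (L : Vec →L[ℝ] E' →L[ℝ] F)
    {f : Pt → Vec} (hf : LocallyIntegrable f) {g : Pt × Pt → E'} (hg : ContDiff ℝ ∞ g)
    {K : Set (Pt × Pt)} (hK : IsCompact K) (hgK : ∀ p, p ∉ K → g p = 0) :
    fderiv ℝ (diagOp L f g) =
      (ContinuousLinearMap.compL ℝ Pt (Pt × Pt) F).flip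
        ((ContinuousLinearMap.id ℝ Pt).prod (ContinuousLinearMap.id ℝ Pt)) ∘
        diagOp (L.precompR (Pt × Pt)) f (fderiv ℝ g) := by
  funext x
  have h := hasFDerivAt_convolution_right_with_param (𝕜 := ℝ) (μ := volume) L (f := f)
    (g := fun x y => g (x, y)) (s := Set.univ) isOpen_univ (hK.image continuous_snd)
    (fun p x _ hx => hgK _ fun h => hx ⟨_, h, rfl⟩) hf (hg.of_le (by simp)).contDiffOn (x, x)
    (Set.mem_univ _)
  have h2 := HasFDerivAt.comp (f := fun y : Pt => (y, y)) x h
    ((hasFDerivAt_id x).prodMk (hasFDerivAt_id x))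
  exact h2.fderiv

theorem diagOp_bound {f : Pt → Vec} (hf : LocallyIntegrable f)
    {K : Set (Pt × Pt)} (hK : IsCompact K) (i : ℕ) :
    ∀ {E' F : Type} [NormedAddCommGroup E'] [NormedSpace ℝ E']
    [NormedAddCommGroup F] [NormedSpace ℝ F] (L : Vec →L[ℝ] E' →L[ℝ] F),
    ∃ C : ℝ, 0 ≤ C ∧ ∀ (g : Pt × Pt → E') (B : ℝ), ContDiff ℝ ∞ g → (∀ p, p ∉ K → g p = 0) →
      (∀ p, ‖iteratedFDeriv ℝ i g p‖ ≤ B) →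
      ∀ x, ‖iteratedFDeriv ℝ i (diagOp L f g) x‖ ≤ C * B := by
  induction i with
  | zero =>
    intro E' F _ _ _ _ L
    have hK' : IsCompact ((fun p : Pt × Pt => p.1 - p.2) '' K) := hK.image (by fun_prop)
    have hi := (hf.integrableOn_isCompact hK').norm
    refine ⟨‖L‖ * ∫ t in (fun p : Pt × Pt => p.1 - p.2) '' K, ‖f t‖, by positivity, ?_⟩
    intro g B hg hgK hB x
    simp only [norm_iteratedFDeriv_zero] at hB ⊢
    have hB0 : 0 ≤ B := (norm_nonneg _).trans (hB 0)
    rw [diagOp, ← setIntegral_eq_integral_of_forall_compl_eq_zero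
      (s := (fun p : Pt × Pt => p.1 - p.2) '' K)]
    · refine (norm_integral_le_of_norm_le ((hi.const_mul ‖L‖).mul_const B) ?_).trans ?_
      · filter_upwards with t
        exact (L.le_opNorm₂ _ _).trans (by gcongr; exact hB _)
      · rw [integral_mul_const, integral_const_mul]
    · intro t ht
      rw [hgK, map_zero]
      exact fun h => ht ⟨_, h, by simp⟩
  | succ i ih =>
    intro E' F _ _ _ _ L
    obtain ⟨C, hC, h⟩ := ih (L.precompR (Pt × Pt))
    set T := (ContinuousLinearMap.compL ℝ Pt (Pt × Pt) F).flip
        ((ContinuousLinearMap.id ℝ Pt).prod (ContinuousLinearMap.id ℝ Pt)) with hT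
    refine ⟨‖T‖ * C, by positivity, ?_⟩
    intro g B hg hgK hB x
    have hg' : ContDiff ℝ ∞ (fderiv ℝ g) := hg.fderiv_right (by simp)
    have hgK' : ∀ p, p ∉ K → fderiv ℝ g p = 0 := by
      intro p hp
      have : g =ᶠ[𝓝 p] fun _ => 0 := by
        filter_upwards [hK.isClosed.isOpen_compl.mem_nhds hp] with q hq using hgK q hq
      rw [this.fderiv_eq]; simp
    rw [← norm_iteratedFDeriv_fderiv, diagOp_fderiv L hf hg hK hgK, mul_assoc]
    refine (T.norm_iteratedFDeriv_comp_left
      (diagOp_contDiff (L.precompR (Pt × Pt)) hf hg' hK hgK').contDiffAt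
      (N := ∞) (by exact_mod_cast le_top)).trans ?_
    gcongr
    refine h _ B hg' hgK' (fun p => ?_) x
    rw [norm_iteratedFDeriv_fderiv]; exact hB p

theorem integral_eq_diagOp {F : Type} [NormedAddCommGroup F] [NormedSpace ℂ F]
    (L : Vec →L[ℂ] Vec →L[ℂ] F) (κ s : ℝ) (g : Pt × Pt → Vec) (x : Pt) :
    ∫ y, L (alpha κ s x y) (g (x, y)) =
      diagOp (L.bilinearRestrictScalars ℝ) (fun t => alpha κ s 0 (-t)) g x := by
  rw [← integral_sub_left_eq_self _ volume x, diagOp]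
  refine integral_congr_ae (Eventually.of_forall fun t => ?_)
  have : alpha κ s x (x - t) = alpha κ s 0 (-t) := by
    unfold alpha; simp
  simp [this]

/-- Test functions `C_c^∞(ℝ³ × ℝ³)` with values in vectors. -/
abbrev TwoPtTest := 𝓓((⊤ : Opens (Pt × Pt)), Vec)

/-- The nonlocal operator `x ↦ ∫ L(α(x,y), Ψ(x,y) + Ψ(y,x)) dy` on two-point fields: for `L` the
scalar product it is the fractional divergence `𝒟`, for `L` the cross product the fractional
curl `𝒞`. -/
noncomputable def testOpFun {F : Type} [NormedAddCommGroup F] [NormedSpace ℂ F]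
    (L : Vec →L[ℂ] Vec →L[ℂ] F) (κ s : ℝ) (Ψ : Pt × Pt → Vec) (x : Pt) : F :=
  ∫ y, L (alpha κ s x y) (Ψ (x, y) + Ψ (y, x))

theorem testOpFun_eq {F : Type} [NormedAddCommGroup F] [NormedSpace ℂ F]
    (L : Vec →L[ℂ] Vec →L[ℂ] F) (κ s : ℝ) (Ψ : Pt × Pt → Vec) :
    testOpFun L κ s Ψ =
      diagOp (L.bilinearRestrictScalars ℝ) (fun t => alpha κ s 0 (-t)) (fun p => Ψ p + Ψ p.swap) :=
  funext fun x => integral_eq_diagOp L κ s (fun p => Ψ p + Ψ p.swap) x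

theorem testOpFun_zero {F : Type} [NormedAddCommGroup F] [NormedSpace ℂ F]
    (L : Vec →L[ℂ] Vec →L[ℂ] F) (κ s : ℝ) {Ψ : Pt × Pt → Vec} {K : Set (Pt × Pt)}
    (hΨ : ∀ p, p ∉ K → Ψ p = 0) {x : Pt} (hx : x ∉ Prod.fst '' K ∪ Prod.snd '' K) :
    testOpFun L κ s Ψ x = 0 := by
  unfold testOpFun
  have h (y : Pt) : Ψ (x, y) = 0 := hΨ _ fun h => hx (Or.inl ⟨_, h, rfl⟩)
  have h' (y : Pt) : Ψ (y, x) = 0 := hΨ _ fun h => hx (Or.inr ⟨_, h, rfl⟩)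
  simp [h, h']

theorem testOpFun_contDiff {F : Type} [NormedAddCommGroup F] [NormedSpace ℂ F]
    (L : Vec →L[ℂ] Vec →L[ℂ] F) (κ : ℝ) {s : ℝ} (hs : s < 1) {Ψ : Pt × Pt → Vec}
    (hΨ : ContDiff ℝ ∞ Ψ) {K : Set (Pt × Pt)} (hK : IsCompact K) (hΨK : ∀ p, p ∉ K → Ψ p = 0) :
    ContDiff ℝ ∞ (testOpFun L κ s Ψ) := by
  rw [testOpFun_eq]
  refine diagOp_contDiff _ (alpha_locallyIntegrable κ hs) (K := K ∪ Prod.swap '' K) ?_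
    (hK.union (hK.image continuous_swap)) ?_
  · exact hΨ.add (hΨ.comp (contDiff_snd.prodMk contDiff_fst))
  · intro p hp
    rw [hΨK p fun h => hp (Or.inl h), hΨK p.swap fun h => hp (Or.inr ⟨_, h, by simp⟩), add_zero]

theorem testOpFun_hasCompactSupport {F : Type} [NormedAddCommGroup F] [NormedSpace ℂ F]
    (L : Vec →L[ℂ] Vec →L[ℂ] F) (κ s : ℝ) {Ψ : Pt × Pt → Vec} {K : Set (Pt × Pt)}
    (hK : IsCompact K) (hΨ : ∀ p, p ∉ K → Ψ p = 0) : HasCompactSupport (testOpFun L κ s Ψ) :=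
  HasCompactSupport.intro ((hK.image continuous_fst).union (hK.image continuous_snd))
    fun _ hx => testOpFun_zero L κ s hΨ hx

theorem testOpFun_bound {F : Type} [NormedAddCommGroup F] [NormedSpace ℂ F]
    (L : Vec →L[ℂ] Vec →L[ℂ] F) (κ : ℝ) {s : ℝ} (hs : s < 1) {K : Set (Pt × Pt)}
    (hK : IsCompact K) (k i : ℕ) :
    ∃ C : ℝ, 0 ≤ C ∧ ∀ (Ψ : Pt × Pt → Vec) (B : ℝ), ContDiff ℝ ∞ Ψ → (∀ p, p ∉ K → Ψ p = 0) →
      (∀ p, ‖iteratedFDeriv ℝ i Ψ p‖ ≤ B) →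
      ∀ x, ‖x‖ ^ k * ‖iteratedFDeriv ℝ i (testOpFun L κ s Ψ) x‖ ≤ C * B := by
  have hK₁ : IsCompact (Prod.fst '' K ∪ Prod.snd '' K) :=
    (hK.image continuous_fst).union (hK.image continuous_snd)
  have hK₂ : IsCompact (K ∪ Prod.swap '' K) := hK.union (hK.image continuous_swap)
  obtain ⟨R, hR0, hR⟩ := hK₁.isBounded.exists_pos_norm_le
  obtain ⟨C, hC, h⟩ := diagOp_bound (alpha_locallyIntegrable κ hs) hK₂ i
    (L.bilinearRestrictScalars ℝ)
  refine ⟨R ^ k * (C * 2), by positivity, fun Ψ B hΨ hΨK hB x => ?_⟩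
  have hB0 : 0 ≤ B := (norm_nonneg _).trans (hB 0)
  by_cases hx : x ∈ Prod.fst '' K ∪ Prod.snd '' K
  · rw [mul_assoc]
    gcongr
    · exact hR x hx
    · rw [testOpFun_eq, mul_assoc]
      have hsw : ContDiff ℝ ∞ fun p : Pt × Pt => Ψ p.swap :=
        hΨ.comp (contDiff_snd.prodMk contDiff_fst)
      refine h _ _ (hΨ.add hsw) ?_ ?_ x
      · intro p hp
        rw [hΨK p fun h => hp (Or.inl h), hΨK p.swap fun h => hp (Or.inr ⟨_, h, by simp⟩),
          add_zero]
      · intro p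
        have e := (LinearIsometryEquiv.prodComm ℝ Pt Pt).norm_iteratedFDeriv_comp_right Ψ p i
        have e' := hB (LinearIsometryEquiv.prodComm ℝ Pt Pt p)
        rw [← e] at e'
        rw [fun_iteratedFDeriv_add (hΨ.of_le (by exact_mod_cast le_top))
          (hsw.of_le (by exact_mod_cast le_top)), two_mul]
        exact (norm_add_le _ _).trans (add_le_add (hB p) e')
  · have h0 : testOpFun L κ s Ψ =ᶠ[𝓝 x] fun _ => 0 := by
      filter_upwards [hK₁.isClosed.isOpen_compl.mem_nhds hx] with q hq using
        testOpFun_zero L κ s hΨK hq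
    rw [(h0.iteratedFDeriv ℝ i).eq_of_nhds]
    simp; positivity

theorem twoPtTest_zero_off (Ψ : TwoPtTest) : ∀ p, p ∉ tsupport Ψ → Ψ p = 0 :=
  fun _ hp => image_eq_zero_of_notMem_tsupport hp

theorem testOpFun_integrable {F : Type} [NormedAddCommGroup F] [NormedSpace ℂ F]
    (L : Vec →L[ℂ] Vec →L[ℂ] F) (κ : ℝ) {s : ℝ} (hs : s < 1) (Ψ : TwoPtTest) (x : Pt) :
    Integrable fun y => L (alpha κ s x y) (Ψ (x, y) + Ψ (y, x)) := by
  have hc : HasCompactSupport fun y => Ψ (x, y) + Ψ (y, x) := by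
    have hK := Ψ.hasCompactSupport.isCompact
    refine HasCompactSupport.intro ((hK.image continuous_fst).union (hK.image continuous_snd))
      fun y hy => ?_
    rw [twoPtTest_zero_off Ψ _ fun h => hy (Or.inr ⟨_, h, rfl⟩),
      twoPtTest_zero_off Ψ _ fun h => hy (Or.inl ⟨_, h, rfl⟩), add_zero]
  have h := (hc.convolutionExists_right (μ := volume) (L.bilinearRestrictScalars ℝ)
    (alpha_locallyIntegrable κ hs) (by fun_prop) x).comp_sub_left x
  refine h.congr (Eventually.of_forall fun y => ?_)
  have : alpha κ s 0 (y - x) = alpha κ s x y := by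
    unfold alpha; simp
  simp [this]

/-- The nonlocal operator given by `L` on test functions; its values are smooth and compactly
supported. -/
noncomputable def testOpLM {F : Type} [NormedAddCommGroup F] [NormedSpace ℂ F]
    (L : Vec →L[ℂ] Vec →L[ℂ] F) (κ : ℝ) (s : Set.Ioo (0 : ℝ) 1) : TwoPtTest →ₗ[ℂ] 𝓢(Pt, F) where
  toFun Ψ := (testOpFun_hasCompactSupport L κ s Ψ.hasCompactSupport
        (twoPtTest_zero_off Ψ)).toSchwartzMap
      (testOpFun_contDiff L κ s.2.2 Ψ.contDiff Ψ.hasCompactSupport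
        (twoPtTest_zero_off Ψ))
  map_add' Ψ Φ := by
    ext x
    simp only [HasCompactSupport.toSchwartzMap_toFun, add_apply]
    unfold testOpFun
    rw [← integral_add (testOpFun_integrable L κ s.2.2 Ψ x) (testOpFun_integrable L κ s.2.2 Φ x)]
    refine integral_congr_ae (Eventually.of_forall fun y => ?_)
    simp only [FunLike.coe_add, Pi.add_apply, map_add]; abel
  map_smul' a Ψ := by
    ext x
    simp only [HasCompactSupport.toSchwartzMap_toFun, smul_apply, RingHom.id_apply]
    unfold testOpFun
    rw [← integral_smul]
    refine integral_congr_ae (Eventually.of_forall fun y => ?_)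
    simp [smul_add]

theorem testOpLM_apply {F : Type} [NormedAddCommGroup F] [NormedSpace ℂ F]
    (L : Vec →L[ℂ] Vec →L[ℂ] F) (κ : ℝ) (s : Set.Ioo (0 : ℝ) 1) (Ψ : TwoPtTest) (x : Pt) :
    testOpLM L κ s Ψ x = ∫ y, L (alpha κ s x y) (Ψ (x, y) + Ψ (y, x)) := rfl

theorem testOpLM_continuous {F : Type} [NormedAddCommGroup F] [NormedSpace ℂ F]
    (L : Vec →L[ℂ] Vec →L[ℂ] F) (κ : ℝ) (s : Set.Ioo (0 : ℝ) 1) :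
    Continuous (testOpLM L κ s) := by
  rw [TestFunction.continuous_iff_continuous_comp]
  intro K hKΩ
  have h : Continuous
      (testOpLM L κ s ∘ₗ (TestFunction.ofSupportedInCLM ℂ hKΩ).toLinearMap) := by
    refine WithSeminorms.continuous_of_isBounded
      (ContDiffMapSupportedIn.withSeminorms ℂ (Pt × Pt) Vec ⊤ K)
      (schwartz_withSeminorms ℂ Pt F) _ (.of_real fun n => ?_)
    obtain ⟨C, hC, hb⟩ := testOpFun_bound L κ s.2.2 K.isCompact n.1 n.2
    refine ⟨{n.2}, C, fun Ψ => ?_⟩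
    refine SchwartzMap.seminorm_le_bound ℂ n.1 n.2 _ (by positivity) fun x => ?_
    simp only [Finset.sup_singleton]
    exact hb Ψ _ Ψ.contDiff (fun p hp => Ψ.zero_on_compl hp)
      (fun p => ContDiffMapSupportedIn.norm_iteratedFDeriv_apply_le_seminorm_top ℂ) x
  exact h

/-- The fractional divergence `𝒟Ψ(x) = ∫ (Ψ(x,y) + Ψ(y,x)) · α(x,y) dy` of test functions. -/
noncomputable def divTest (κ : ℝ) (s : Set.Ioo (0 : ℝ) 1) : TwoPtTest →L[ℂ] 𝓢(Pt, ℂ) :=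
  ⟨testOpLM dotL κ s, testOpLM_continuous dotL κ s⟩

/-- The fractional curl `𝒞Ψ(x) = ∫ α(x,y) × (Ψ(x,y) + Ψ(y,x)) dy` of test functions. -/
noncomputable def curlTest (κ : ℝ) (s : Set.Ioo (0 : ℝ) 1) : TwoPtTest →L[ℂ] 𝓢(Pt, Vec) :=
  ⟨testOpLM crossL κ s, testOpLM_continuous crossL κ s⟩

theorem divTest_apply (κ : ℝ) (s : Set.Ioo (0 : ℝ) 1) (Ψ : TwoPtTest) (x : Pt) :
    divTest κ s Ψ x = ∫ y, dot (alpha κ s x y) (Ψ (x, y) + Ψ (y, x)) := rfl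

theorem curlTest_apply (κ : ℝ) (s : Set.Ioo (0 : ℝ) 1) (Ψ : TwoPtTest) (x : Pt) :
    curlTest κ s Ψ x = ∫ y, cross (alpha κ s x y) (Ψ (x, y) + Ψ (y, x)) := rfl

/-- Vector-valued two-point distributions: the continuous functionals on vector-valued test
functions on `ℝ³ × ℝ³`. -/
abbrev TwoPt := TwoPtTest →L[ℂ] ℂ

/-- `𝒟*φ` for a distribution `φ`, given by `⟨𝒟*φ, Ψ⟩ = ⟨φ, 𝒟Ψ⟩`. -/
noncomputable def Dstar (κ : ℝ) (s : Set.Ioo (0 : ℝ) 1) : 𝓢'(Pt, ℂ) →ₗ[ℂ] TwoPt where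
  toFun φ :=
    { toFun := fun Ψ => φ (divTest κ s Ψ)
      map_add' := fun _ _ => by simp only [map_add]
      map_smul' := fun _ _ => by simp only [map_smul, RingHom.id_apply]
      cont := (ContinuousLinearMap.cont (φ : 𝓢(Pt, ℂ) →L[ℂ] ℂ)).comp (divTest κ s).cont }
  map_add' _ _ := rfl
  map_smul' _ _ := rfl

/-- `𝒞*A` for a vector-valued distribution `A`, given by
`⟨𝒞*A, Ψ⟩ = ⟨A, 𝒞Ψ⟩ = ∑ᵢ ⟨Aᵢ, (𝒞Ψ)ᵢ⟩`. -/
noncomputable def Cstar (κ : ℝ) (s : Set.Ioo (0 : ℝ) 1) : 𝓢'(Pt, Vec) →ₗ[ℂ] TwoPt where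
  toFun A :=
    { toFun := fun Ψ => ∑ i, A ((curlTest κ s Ψ).postcompCLM (EuclideanSpace.proj i)) i
      map_add' := fun _ _ => by
        simp only [map_add, PiLp.add_apply, Finset.sum_add_distrib]
      map_smul' := fun _ _ => by
        simp only [map_smul, PiLp.smul_apply, Finset.smul_sum, RingHom.id_apply]
      cont := continuous_finsetSum _ fun i _ =>
        (EuclideanSpace.proj i : Vec →L[ℂ] ℂ).cont.comp
          ((ContinuousLinearMap.cont (A : 𝓢(Pt, ℂ) →L[ℂ] Vec)).comp
            ((SchwartzMap.postcompCLM (EuclideanSpace.proj i : Vec →L[ℂ] ℂ)).cont.comp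
              (curlTest κ s).cont)) }
  map_add' _ _ := by
    ext Ψ
    simp [Finset.sum_add_distrib]
  map_smul' _ _ := by
    ext Ψ
    simp [Finset.mul_sum]

/-- `∇ · A = 0` in the sense of distributions, i.e. `⟨A, ∇ψ⟩ = 0` for all `ψ`. -/
def IsDivFree (A : 𝓢'(Pt, Vec)) : Prop :=
  ∀ ψ : 𝓢(Pt, ℂ), ∑ i, A (∂_{EuclideanSpace.single i (1 : ℝ)} ψ) i = 0

/-- `φ, A ∈ H^t(ℝ³)` and `∇ · A = 0`. -/
structure IsPotentials (t : ℝ) (φ : 𝓢'(Pt, ℂ)) (A : 𝓢'(Pt, Vec)) : Prop where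
  memSobolev_scalar : MemSobolev t 2 φ
  memSobolev_vector : MemSobolev t 2 A
  divFree : IsDivFree A

theorem IsPotentials.add {t : ℝ} {φ φ' : 𝓢'(Pt, ℂ)} {A A' : 𝓢'(Pt, Vec)}
    (h : IsPotentials t φ A) (h' : IsPotentials t φ' A') : IsPotentials t (φ + φ') (A + A') :=
  ⟨h.1.add h'.1, h.2.add h'.2, fun ψ => by
    have e := congrArg₂ (· + ·) (h.3 ψ) (h'.3 ψ)
    simpa [Finset.sum_add_distrib] using e⟩

theorem IsPotentials.smul {t : ℝ} {φ : 𝓢'(Pt, ℂ)} {A : 𝓢'(Pt, Vec)}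
    (h : IsPotentials t φ A) (a : ℂ) : IsPotentials t (a • φ) (a • A) :=
  ⟨h.1.smul a, h.2.smul a, fun ψ => by
    have e := congrArg (a * ·) (h.3 ψ)
    simpa [Finset.mul_sum] using e⟩

/-- The space `H^r_{fHd}(ℝ³ × ℝ³) = {𝒟*φ + 𝒞*A : φ, A ∈ H^{r+s}(ℝ³), ∇ · A = 0}`. -/
noncomputable def Hfhd (κ : ℝ) (s : Set.Ioo (0 : ℝ) 1) (r : ℝ) : Submodule ℂ TwoPt where
  carrier := {v | ∃ φ A, IsPotentials (r + s) φ A ∧ v = Dstar κ s φ + Cstar κ s A}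
  zero_mem' := ⟨0, 0, ⟨memSobolev_fun_zero _ _ _ _, memSobolev_fun_zero _ _ _ _,
    fun ψ => by simp⟩, by simp⟩
  add_mem' := by
    rintro _ _ ⟨φ, A, h, rfl⟩ ⟨φ', A', h', rfl⟩
    exact ⟨φ + φ', A + A', h.add h', by simp only [map_add]; abel⟩
  smul_mem' := by
    rintro a _ ⟨φ, A, h, rfl⟩
    exact ⟨a • φ, a • A, h.smul a, by simp only [map_smul, smul_add]⟩

/-- Convergence `u n → u₀` in the Sobolev space `H^t(ℝ³)` (all terms belonging to `H^t`):
convergence of the Bessel potentials of order `t` in `L²`. -/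
def HsTendsto {F : Type} [NormedAddCommGroup F] [InnerProductSpace ℂ F] [CompleteSpace F]
    (t : ℝ) (u : ℕ → 𝓢'(Pt, F)) (u₀ : 𝓢'(Pt, F)) : Prop :=
  ∃ (g : ℕ → Lp F 2 (volume : Measure Pt)) (g₀ : Lp F 2 (volume : Measure Pt)),
    (∀ n, besselPotential Pt F t (u n) = (g n : 𝓢'(Pt, F))) ∧
    besselPotential Pt F t u₀ = (g₀ : 𝓢'(Pt, F)) ∧ Tendsto g atTop (𝓝 g₀)

/-- The tempered distribution `T` is given by integration against the function `f`. -/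
def Represents {F : Type} [NormedAddCommGroup F] [NormedSpace ℂ F]
    (T : 𝓢'(Pt, F)) (f : Pt → F) : Prop :=
  ∀ ψ : 𝓢(Pt, ℂ), Integrable (fun x => ψ x • f x) ∧ T ψ = ∫ x, ψ x • f x

/-- The pointwise operator `𝒟*u(x,y) = -(u(y) - u(x)) α(x,y)`. -/
noncomputable def DstarFun (κ s : ℝ) (u : Pt → ℂ) (x y : Pt) : Vec :=
  -(u y - u x) • alpha κ s x y

/-- The pointwise operator `𝒞*w(x,y) = α(x,y) × (w(y) - w(x))`. -/
noncomputable def CstarFun (κ s : ℝ) (w : Pt → Vec) (x y : Pt) : Vec :=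
  cross (alpha κ s x y) (w y - w x)

/-- The pointwise projection `Πv(x) = c ∫ v(x,y) / |x - y|^{n/2} dy`, `n = 3`. -/
noncomputable def PiFun (c : ℝ) (v : Pt → Pt → Vec) (x : Pt) : Vec :=
  c • ∫ y, (‖x - y‖ ^ ((3 : ℝ) / 2))⁻¹ • v x y

/-- `g = (Π𝒞*)f`, where `Π𝒞* : H^t(ℝ³) → H^{t-s}(ℝ³)` is the extension by density of the operator
`w ↦ Π(𝒞*w)`, which is given by the pointwise formulas for rapidly decreasing `w`. -/
def HasPiCurl (κ c : ℝ) (s : Set.Ioo (0 : ℝ) 1) (t : ℝ) (f g : 𝓢'(Pt, Vec)) : Prop :=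
  ∃ (w : ℕ → 𝓢(Pt, Vec)) (h : ℕ → 𝓢'(Pt, Vec)),
    HsTendsto t (fun n => (w n : 𝓢'(Pt, Vec))) f ∧
    (∀ n, Represents (h n) (PiFun c (CstarFun κ s (w n)))) ∧
    HsTendsto (t - s) h g

/-- `u = Πv` for `v = 𝒟*φ + 𝒞*A ∈ H^r_{fHd}`, where `Π : H^r_{fHd} → H^r(ℝ³)` is the extension by
density of the pointwise formula, in terms of the potentials `φ, A ∈ H^{r+s}`. -/
def HasPi (κ c : ℝ) (s : Set.Ioo (0 : ℝ) 1) (r : ℝ) (v : TwoPt) (u : 𝓢'(Pt, Vec)) : Prop :=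
  ∃ φ A, IsPotentials (r + s) φ A ∧ v = Dstar κ s φ + Cstar κ s A ∧
    ∃ (φn : ℕ → 𝓢(Pt, ℂ)) (An : ℕ → 𝓢(Pt, Vec)) (h : ℕ → 𝓢'(Pt, Vec)),
      HsTendsto (r + s) (fun n => (φn n : 𝓢'(Pt, ℂ))) φ ∧
      HsTendsto (r + s) (fun n => (An n : 𝓢'(Pt, Vec))) A ∧
      (∀ n, Represents (h n)
        (PiFun c fun x y => DstarFun κ s (φn n) x y + CstarFun κ s (An n) x y)) ∧
      HsTendsto r h u

/-- `w = 𝒞̃v`, where `𝒞̃ = Π⁻¹(Π𝒞*)Π`: that is, `w ∈ H^{r-s}_{fHd}` and `Πw = (Π𝒞*)(Πv)`. -/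
def HasTwoPtCurl (κ c : ℝ) (s : Set.Ioo (0 : ℝ) 1) (r : ℝ) (v w : TwoPt) : Prop :=
  ∃ u g, HasPi κ c s r v u ∧ HasPiCurl κ c s r u g ∧ HasPi κ c s (r - s) w g

/-- `g = 𝒟v` for `v = 𝒟*φ + 𝒞*A ∈ H^r_{fHd}`. For rapidly decreasing potentials `v` is a square
integrable function and `𝒟v` is defined by duality, `⟨𝒟v, ψ⟩ = ∫∫ v · 𝒟*ψ`; in general
`𝒟 : H^r_{fHd} → H^{r-s}(ℝ³)` is the extension by density in terms of the potentials. -/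
def HasDiv (κ : ℝ) (s : Set.Ioo (0 : ℝ) 1) (r : ℝ) (v : TwoPt) (g : 𝓢'(Pt, ℂ)) : Prop :=
  ∃ φ A, IsPotentials (r + s) φ A ∧ v = Dstar κ s φ + Cstar κ s A ∧
    ∃ (φn : ℕ → 𝓢(Pt, ℂ)) (An : ℕ → 𝓢(Pt, Vec)) (h : ℕ → 𝓢'(Pt, ℂ)),
      HsTendsto (r + s) (fun n => (φn n : 𝓢'(Pt, ℂ))) φ ∧
      HsTendsto (r + s) (fun n => (An n : 𝓢'(Pt, Vec))) A ∧
      (∀ n, ∀ ψ : 𝓢(Pt, ℂ), h n ψ = ∫ p : Pt × Pt,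
        dot (DstarFun κ s (φn n) p.1 p.2 + CstarFun κ s (An n) p.1 p.2)
          (DstarFun κ s ψ p.1 p.2)) ∧
      HsTendsto (r - s) h g

end FracCurl

open FracCurl

namespace FracCurl
set_option linter.unusedSectionVars false
open FourierTransform

/-! On the Fourier side the theorem is linear algebra at almost every frequency. For rapidly
decreasing potentials, `Π𝒞*` and `Π𝒟*` integrate the increments `w(x + z) - w(x)` against the vector
kernel `k(z) = |z|^{-3/2} α(0,z)`. By Fubini (`nonlocal_integrable_and_eq`) they are the multipliers
`ŵ ↦ c m × ŵ` and `φ̂ ↦ -c φ̂ m`, where `m(ξ) = ∫ (e^{2πi z·ξ} - 1) k(z) dz` is `msym`. Homogeneity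
of degree `s` gives `|m(ξ)| ≤ B (1 + |ξ|²)^{s/2}`, so the extensions by density are bounded
multipliers between weighted `L²` spaces (`hasPiCurl_iff`, `hasPi_iff`). Covariance under isometries
makes `m(ξ)` parallel to `ξ`, and a positive integral excludes `m(ξ) = 0` for `ξ ≠ 0`
(`exists_msym_eq`).

Three facts about vectors then decide the matter. Since `m × m = 0`, the curl symbol annihilates
gradient parts (`mulOp_rotL_gradL`). Since `ξ · (m × w) = 0`, the field `B = Π𝒞*A` is divergence
free, hence an admissible potential (`mulOp_rotL_divFree`). Finally, `-φ m + m × w = m × w'` with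
`w`, `w'` orthogonal to `ξ` forces `φ = 0` and `w = w'` (`eq_of_mulOp_eq`). So `𝒞*B` is the only
element of the target space that `Π` sends to `Π𝒞*Πv = Π𝒞*B`.

As the operators are written through potentials, a field must determine its potentials
(`potentials_unique`). Testing a vanishing field against functions supported off the diagonal, with
the radial factor of `α` divided out, isolates each component of `φ` and `A` on second derivatives
of test functions; an element of a Sobolev space that vanishes on all of these is zero.

For the divergence, `𝒞*A` is pointwise orthogonal to `α` while `𝒟*ψ` is a multiple of `α`. Hence
`𝒟v` depends on the scalar potential alone, and that potential is zero for the two-point curl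
(`hasDiv_cstar_iff`). -/

/-- The weight `(1 + |ξ|²)^{t/2}`. -/
noncomputable def jw (t : ℝ) (ξ : Pt) : ℝ := (1 + ‖ξ‖ ^ 2) ^ (t / 2)

theorem jw_pos (t : ℝ) (ξ : Pt) : 0 < jw t ξ := by unfold jw; positivity

theorem jw_add (t t' : ℝ) (ξ : Pt) : jw (t + t') ξ = jw t ξ * jw t' ξ := by
  unfold jw; rw [← Real.rpow_add (by positivity)]; congr 1; ring

theorem jw_neg_mul (t : ℝ) (ξ : Pt) : jw (-t) ξ * jw t ξ = 1 := by
  rw [← jw_add]; simp [jw]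

theorem jw_temperate (t : ℝ) : (fun ξ => ((jw t ξ : ℝ) : ℂ)).HasTemperateGrowth := by
  unfold jw; fun_prop

theorem jw_continuous (t : ℝ) : Continuous (jw t) := by
  unfold jw
  refine Continuous.rpow_const (by fun_prop) fun x => Or.inl (by positivity)

/-! ### Sobolev spaces and Sobolev convergence on the Fourier side -/

section Hat

variable {F : Type} [NormedAddCommGroup F] [InnerProductSpace ℂ F] [CompleteSpace F]

/-- The Fourier transform of `u` is the function `(1 + |ξ|²)^{-t/2} G(ξ)`, with `G ∈ L²`. -/
def HasHat (t : ℝ) (u : 𝓢'(Pt, F)) (G : Lp F 2 (volume : Measure Pt)) : Prop :=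
  ∀ ψ : 𝓢(Pt, ℂ), u (𝓕 ψ) = ∫ ξ, ψ ξ • ((jw (-t) ξ : ℂ) • G ξ)

/-- The Bessel potential is multiplication by `jw t` after Fourier transform, and multiplication by
`jw (-t)` on Schwartz functions undoes it. This allows every later argument to work with an `L²`
density instead of the Bessel potential. -/
theorem hasHat_iff {t : ℝ} {u : 𝓢'(Pt, F)} {G : Lp F 2 (volume : Measure Pt)} :
    HasHat t u G ↔ besselPotential Pt F t u = ((𝓕⁻ G : Lp F 2 (volume : Measure Pt)) : 𝓢'(Pt, F)) := by
  rw [← Lp.fourierInv_toTemperedDistribution_eq]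
  have h1 : besselPotential Pt F t u = 𝓕⁻ (G : 𝓢'(Pt, F)) ↔
      smulLeftCLM F (fun ξ => (jw t ξ : ℂ)) (𝓕 u) = (G : 𝓢'(Pt, F)) := by
    have e := fourier_besselPotential_eq_smulLeftCLM_fourier_apply t u
    constructor
    · intro h
      rw [h, fourier_fourierInv_eq] at e
      exact e.symm
    · intro h
      have : 𝓕 (besselPotential Pt F t u) = (G : 𝓢'(Pt, F)) := e.trans h
      rw [← this, fourierInv_fourier_eq]
  rw [h1]
  have key : ∀ (a b : ℝ) (_ : a + b = 0) (ψ : 𝓢(Pt, ℂ)),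
      SchwartzMap.smulLeftCLM ℂ (fun ξ => (jw a ξ : ℂ))
        (SchwartzMap.smulLeftCLM ℂ (fun ξ => (jw b ξ : ℂ)) ψ) = ψ := by
    intro a b hab ψ
    ext ξ
    rw [SchwartzMap.smulLeftCLM_apply_apply (jw_temperate a),
      SchwartzMap.smulLeftCLM_apply_apply (jw_temperate b), smul_smul, ← Complex.ofReal_mul,
      ← jw_add, hab]
    simp [jw]
  constructor
  · intro h
    ext ψ
    rw [smulLeftCLM_apply_apply, TemperedDistribution.fourier_apply, h, Lp.toTemperedDistribution_apply]
    refine integral_congr_ae (Eventually.of_forall fun ξ => ?_)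
    simp only [SchwartzMap.smulLeftCLM_apply_apply (jw_temperate t), smul_smul, smul_eq_mul]
    congr 1
    rw [mul_right_comm, ← Complex.ofReal_mul, mul_comm (jw t ξ), jw_neg_mul]; simp
  · intro h ψ
    have h2 := DFunLike.congr_fun h (SchwartzMap.smulLeftCLM ℂ (fun ξ => (jw (-t) ξ : ℂ)) ψ)
    rw [smulLeftCLM_apply_apply, TemperedDistribution.fourier_apply, key _ _ (by ring),
      Lp.toTemperedDistribution_apply] at h2
    rw [h2]
    refine integral_congr_ae (Eventually.of_forall fun ξ => ?_)
    simp only [SchwartzMap.smulLeftCLM_apply_apply (jw_temperate (-t)), smul_smul, smul_eq_mul]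
    rw [mul_comm]

theorem toTemperedDistribution_injective :
    Function.Injective (Lp.toTemperedDistribution : Lp F 2 (volume : Measure Pt) → 𝓢'(Pt, F)) :=
  LinearMap.ker_eq_bot.1 (Lp.ker_toTemperedDistributionCLM_eq_bot (F := F)
    (μ := (volume : Measure Pt)) (p := 2))

theorem HasHat.unique {t : ℝ} {u : 𝓢'(Pt, F)} {G G' : Lp F 2 (volume : Measure Pt)}
    (h : HasHat t u G) (h' : HasHat t u G') : G = G' := by
  rw [hasHat_iff] at h h'
  have := toTemperedDistribution_injective (h.symm.trans h')
  simpa using congrArg 𝓕 this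

theorem HasHat.ext {t : ℝ} {u u' : 𝓢'(Pt, F)} {G : Lp F 2 (volume : Measure Pt)}
    (h : HasHat t u G) (h' : HasHat t u' G) : u = u' := by
  ext ψ
  have := (h (𝓕⁻ ψ)).trans (h' (𝓕⁻ ψ)).symm
  simpa using this

theorem exists_hasHat (t : ℝ) (G : Lp F 2 (volume : Measure Pt)) : ∃ u, HasHat t u G := by
  refine ⟨besselPotential Pt F (-t) ((𝓕⁻ G : Lp F 2 (volume : Measure Pt)) : 𝓢'(Pt, F)), ?_⟩
  rw [hasHat_iff]; simp

theorem memSobolev_iff_hasHat {t : ℝ} {u : 𝓢'(Pt, F)} :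
    MemSobolev t 2 u ↔ ∃ G, HasHat t u G := by
  simp only [hasHat_iff]
  constructor
  · rintro ⟨g, hg⟩
    exact ⟨𝓕 g, by rw [hg, fourierInv_fourier_eq]⟩
  · rintro ⟨G, hG⟩
    exact ⟨_, hG⟩

theorem HasHat.add {t : ℝ} {u u' : 𝓢'(Pt, F)} {G G' : Lp F 2 (volume : Measure Pt)}
    (h : HasHat t u G) (h' : HasHat t u' G') : HasHat t (u + u') (G + G') := by
  rw [hasHat_iff] at *
  rw [map_add, h, h', fourierInv_add, ← Lp.toTemperedDistributionCLM_apply,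
    ← Lp.toTemperedDistributionCLM_apply, ← Lp.toTemperedDistributionCLM_apply, map_add]

theorem HasHat.smul {t : ℝ} {u : 𝓢'(Pt, F)} {G : Lp F 2 (volume : Measure Pt)}
    (h : HasHat t u G) (a : ℂ) : HasHat t (a • u) (a • G) := by
  rw [hasHat_iff] at *
  rw [map_smul, h, fourierInv_smul, ← Lp.toTemperedDistributionCLM_apply,
    ← Lp.toTemperedDistributionCLM_apply, map_smul]

theorem hasHat_zero (t : ℝ) : HasHat t (0 : 𝓢'(Pt, F)) 0 := by
  obtain ⟨u, hu⟩ := exists_hasHat t (0 : Lp F 2 (volume : Measure Pt))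
  simpa using hu.smul 0

theorem hsTendsto_iff {t : ℝ} {u : ℕ → 𝓢'(Pt, F)} {u₀ : 𝓢'(Pt, F)} :
    HsTendsto t u u₀ ↔ ∃ (G : ℕ → Lp F 2 (volume : Measure Pt)) (G₀ : Lp F 2 (volume : Measure Pt)),
      (∀ n, HasHat t (u n) (G n)) ∧ HasHat t u₀ G₀ ∧ Tendsto G atTop (𝓝 G₀) := by
  simp only [hasHat_iff]
  constructor
  · rintro ⟨g, g₀, h, h₀, hg⟩
    refine ⟨fun n => 𝓕 (g n), 𝓕 g₀, fun n => ?_, ?_, ?_⟩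
    · rw [h, fourierInv_fourier_eq]
    · rw [h₀, fourierInv_fourier_eq]
    · exact ((Lp.fourierTransformₗᵢ Pt F).continuous.tendsto g₀).comp hg
  · rintro ⟨g, g₀, h, h₀, hg⟩
    refine ⟨_, _, h, h₀, ?_⟩
    exact ((Lp.fourierTransformₗᵢ Pt F).symm.continuous.tendsto g₀).comp hg

theorem hasHat_of_eq_integral {t : ℝ} {u : 𝓢'(Pt, F)} {U : Pt → F}
    {G : Lp F 2 (volume : Measure Pt)} (h : ∀ ψ : 𝓢(Pt, ℂ), u (𝓕 ψ) = ∫ ξ, ψ ξ • U ξ)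
    (hG : ∀ᵐ ξ, U ξ = (jw (-t) ξ : ℂ) • G ξ) : HasHat t u G := by
  intro ψ
  rw [h]
  refine integral_congr_ae ?_
  filter_upwards [hG] with ξ hξ
  rw [hξ]

theorem hasHat_schwartz (t : ℝ) (w : 𝓢(Pt, F)) :
    HasHat t (w : 𝓢'(Pt, F))
      ((SchwartzMap.smulLeftCLM F (fun ξ => (jw t ξ : ℂ)) (𝓕 w)).toLp 2) := by
  refine hasHat_of_eq_integral (U := (𝓕 w : 𝓢(Pt, F))) (fun ψ => ?_) ?_
  · rw [SchwartzMap.coe_apply]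
    exact SchwartzMap.integral_fourier_smul_eq ψ w
  · filter_upwards [SchwartzMap.coeFn_toLp
      (SchwartzMap.smulLeftCLM F (fun ξ => (jw t ξ : ℂ)) (𝓕 w)) 2 volume] with ξ hξ
    rw [hξ, SchwartzMap.smulLeftCLM_apply_apply (jw_temperate t), smul_smul,
      ← Complex.ofReal_mul, jw_neg_mul]
    simp

theorem HasHat.schwartz_ae {t : ℝ} {w : 𝓢(Pt, F)} {G : Lp F 2 (volume : Measure Pt)}
    (h : HasHat t (w : 𝓢'(Pt, F)) G) : ∀ᵐ ξ, 𝓕 w ξ = (jw (-t) ξ : ℂ) • G ξ := by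
  rw [h.unique (hasHat_schwartz t w)]
  filter_upwards [SchwartzMap.coeFn_toLp
      (SchwartzMap.smulLeftCLM F (fun ξ => (jw t ξ : ℂ)) (𝓕 w)) 2 volume] with ξ hξ
  rw [hξ, SchwartzMap.smulLeftCLM_apply_apply (jw_temperate t), smul_smul,
      ← Complex.ofReal_mul, jw_neg_mul]
  simp

/-- Schwartz functions are dense in `L²`, and the weights preserve the Schwartz class, so
approximants of the density can be divided by the weight and transformed back. -/
theorem exists_schwartz_tendsto (t : ℝ) (G : Lp F 2 (volume : Measure Pt)) :
    ∃ (w : ℕ → 𝓢(Pt, F)) (W : ℕ → Lp F 2 (volume : Measure Pt)),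
      (∀ n, HasHat t (w n : 𝓢'(Pt, F)) (W n)) ∧ Tendsto W atTop (𝓝 G) := by
  have hd := SchwartzMap.denseRange_toLpCLM (E := Pt) (F := F) (μ := volume) (p := 2)
    ENNReal.ofNat_ne_top
  obtain ⟨W, hW, hl⟩ := mem_closure_iff_seq_limit.1 (hd G)
  choose η hη using hW
  refine ⟨fun n => 𝓕⁻ (SchwartzMap.smulLeftCLM F (fun ξ => (jw (-t) ξ : ℂ)) (η n)), W,
    fun n => ?_, hl⟩
  have h := hasHat_schwartz t (𝓕⁻ (SchwartzMap.smulLeftCLM F (fun ξ => (jw (-t) ξ : ℂ)) (η n)))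
  convert! h
  rw [fourier_fourierInv_eq, ← hη, SchwartzMap.toLpCLM_apply]
  congr 1
  ext ξ
  rw [SchwartzMap.smulLeftCLM_apply_apply (jw_temperate t),
    SchwartzMap.smulLeftCLM_apply_apply (jw_temperate (-t)), smul_smul, ← Complex.ofReal_mul,
    mul_comm, jw_neg_mul]
  simp

end Hat

/-! ### Inverse transforms of integrable functions as distributions -/

section Fourier

variable {F : Type} [NormedAddCommGroup F] [InnerProductSpace ℂ F] [CompleteSpace F]

/-- Self-adjointness of the Fourier integral, applied to the reflection of `U`. Only integrability
of `U` is available, because the symbols multiplying a Schwartz transform need not be smooth. -/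
theorem integral_fourier_smul_fourierInv (ψ : 𝓢(Pt, ℂ)) {U : Pt → F} (hU : Integrable U) :
    ∫ x, (𝓕 ψ) x • 𝓕⁻ U x = ∫ ξ, ψ ξ • U ξ := by
  have h := VectorFourier.integral_fourierIntegral_smul_eq_flip (μ := (volume : Measure Pt))
    (ν := (volume : Measure Pt)) (L := innerₗ Pt) (e := Real.fourierChar)
    (f := (𝓕 ψ : 𝓢(Pt, ℂ))) (g := fun ξ => U (-ξ)) Real.continuous_fourierChar
    continuous_inner (𝓕 ψ).integrable hU.comp_neg
  rw [flip_innerₗ] at h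
  rw [Real.fourierInv_eq_fourier_comp_neg]
  refine h.symm.trans ?_
  rw [← integral_neg_eq_self]
  refine integral_congr_ae (Eventually.of_forall fun ξ => ?_)
  have e : 𝓕 ((𝓕 ψ : 𝓢(Pt, ℂ)) : Pt → ℂ) (-ξ) = ψ ξ := by
    rw [← Real.fourierInv_eq_fourier_neg, ← SchwartzMap.fourierInv_coe, fourierInv_fourier_eq]
  simp only [neg_neg]
  exact congrArg (· • U ξ) e

theorem Represents.fourier {h : 𝓢'(Pt, F)} {U : Pt → F} (hU : Integrable U)
    (hr : Represents h (𝓕⁻ U)) (ψ : 𝓢(Pt, ℂ)) : h (𝓕 ψ) = ∫ ξ, ψ ξ • U ξ := by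
  rw [(hr _).2, integral_fourier_smul_fourierInv ψ hU]

theorem exists_represents {f : Pt → F} (hf : Continuous f) {C : ℝ} (hC : ∀ x, ‖f x‖ ≤ C) :
    ∃ h : 𝓢'(Pt, F), Represents h f := by
  have hm : MemLp f ⊤ (volume : Measure Pt) :=
    memLp_top_of_bound hf.aestronglyMeasurable C (Eventually.of_forall hC)
  refine ⟨(hm.toLp f : 𝓢'(Pt, F)), fun ψ => ⟨?_, ?_⟩⟩
  · exact ψ.integrable.smul_bdd C hf.aestronglyMeasurable (Eventually.of_forall hC)
  · rw [Lp.toTemperedDistribution_apply]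
    refine integral_congr_ae ?_
    filter_upwards [hm.coeFn_toLp] with x hx
    rw [hx]

theorem continuous_fourierInv_of_integrable {U : Pt → F} (hU : Integrable U) :
    Continuous (𝓕⁻ U) := by
  rw [Real.fourierInv_eq_fourier_comp_neg]
  exact VectorFourier.fourierIntegral_continuous Real.continuous_fourierChar
    (L := innerₗ Pt) continuous_inner hU.comp_neg

theorem norm_fourierInv_le (U : Pt → F) (x : Pt) : ‖𝓕⁻ U x‖ ≤ ∫ ξ, ‖U ξ‖ := by
  rw [Real.fourierInv_eq]
  refine (norm_integral_le_integral_norm _).trans_eq ?_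
  simp

end Fourier

/-! ### Frequency form of the divergence-free condition -/

theorem ae_eq_zero_of_schwartz {F : Type} [NormedAddCommGroup F] [InnerProductSpace ℂ F]
    [CompleteSpace F] {f : Pt → F} (hf : LocallyIntegrable f)
    (h : ∀ ψ : 𝓢(Pt, ℂ), ∫ ξ, ψ ξ • f ξ = 0) : f =ᵐ[volume] 0 := by
  refine ae_eq_zero_of_integral_contDiff_smul_eq_zero hf fun g hg hc => ?_
  have hg₁ : HasCompactSupport (Complex.ofRealCLM ∘ g) := hc.comp_left rfl
  have hg₂ : ContDiff ℝ ∞ (Complex.ofRealCLM ∘ g) := by fun_prop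
  simpa using h (hg₁.toSchwartzMap hg₂)

theorem integrable_schwartz_smul {F : Type} [NormedAddCommGroup F] [InnerProductSpace ℂ F]
    (t : ℝ) (ψ : 𝓢(Pt, ℂ)) (G : Lp F 2 (volume : Measure Pt)) :
    Integrable fun ξ => ψ ξ • ((jw t ξ : ℂ) • G ξ) := by
  have h := memLp_one_iff_integrable.1 ((Lp.memLp G).smul (p := 2) (q := 2) (r := 1)
    ((SchwartzMap.smulLeftCLM ℂ (fun ξ => (jw t ξ : ℂ)) ψ).memLp 2 (volume : Measure Pt)))
  refine h.congr (Eventually.of_forall fun ξ => ?_)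
  simp only [Pi.smul_apply', SchwartzMap.smulLeftCLM_apply_apply (jw_temperate t), smul_smul,
    smul_eq_mul, mul_comm]

theorem lineDerivOp_fourier_single (ψ : 𝓢(Pt, ℂ)) (i : Fin 3) :
    ∂_{EuclideanSpace.single i (1 : ℝ)} (𝓕 ψ) =
      𝓕 (-(2 * Real.pi * Complex.I) • SchwartzMap.smulLeftCLM ℂ (fun ξ : Pt => (ξ i : ℂ)) ψ) := by
  rw [SchwartzMap.lineDerivOp_fourier_eq]
  congr 2
  have h : (fun ξ : Pt => inner ℝ ξ (EuclideanSpace.single i (1 : ℝ))).HasTemperateGrowth := by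
    fun_prop
  rw [← SchwartzMap.smulLeftCLM_ofReal ℂ h]
  congr 1
  ext ξ
  simp [EuclideanSpace.inner_single_right]

theorem coord_temperate (i : Fin 3) : (fun ξ : Pt => (ξ i : ℂ)).HasTemperateGrowth := by
  have h : (fun ξ : Pt => inner ℝ ξ (EuclideanSpace.single i (1 : ℝ))).HasTemperateGrowth := by
    fun_prop
  have h2 : (fun ξ : Pt => ((inner ℝ ξ (EuclideanSpace.single i (1 : ℝ)) : ℝ) : ℂ)).HasTemperateGrowth := by
    fun_prop
  simpa [EuclideanSpace.inner_single_right] using h2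

/-- Differentiating `𝓕 ψ` multiplies `ψ` by `-2πi ξᵢ`, so the pairing is a nonzero constant times
the integral of `ψ` against `ξ · G` with a positive weight. -/
theorem isDivFree_iff {t : ℝ} {A : 𝓢'(Pt, Vec)} {G : Lp Vec 2 (volume : Measure Pt)}
    (hA : HasHat t A G) : IsDivFree A ↔ ∀ᵐ ξ, ∑ i, (ξ i : ℂ) * G ξ i = 0 := by
  have key (ψ : 𝓢(Pt, ℂ)) : ∑ i, A (∂_{EuclideanSpace.single i (1 : ℝ)} (𝓕 ψ)) i =
      -(2 * Real.pi * Complex.I) * ∫ ξ, ψ ξ • ((jw (-t) ξ : ℂ) • ∑ i, (ξ i : ℂ) * G ξ i) := by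
    have e (i : Fin 3) : A (∂_{EuclideanSpace.single i (1 : ℝ)} (𝓕 ψ)) i =
        -(2 * Real.pi * Complex.I) *
          ∫ ξ, ψ ξ • ((jw (-t) ξ : ℂ) • ((ξ i : ℂ) * G ξ i)) := by
      rw [lineDerivOp_fourier_single, fourier_smul, map_smul, hA, PiLp.smul_apply, smul_eq_mul]
      congr 1
      refine ((EuclideanSpace.proj i : Vec →L[ℂ] ℂ).integral_comp_comm
        (integrable_schwartz_smul _ _ G)).symm.trans ?_
      refine integral_congr_ae (Eventually.of_forall fun ξ => ?_)
      simp only [SchwartzMap.smulLeftCLM_apply_apply (coord_temperate i), map_smul,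
        PiLp.proj_apply, smul_eq_mul]
      ring
    have ei (i : Fin 3) : Integrable fun ξ => ψ ξ • ((jw (-t) ξ : ℂ) • ((ξ i : ℂ) * G ξ i)) := by
      refine ((EuclideanSpace.proj i : Vec →L[ℂ] ℂ).integrable_comp
        (integrable_schwartz_smul (-t) (SchwartzMap.smulLeftCLM ℂ (fun ξ : Pt => (ξ i : ℂ)) ψ) G)).congr
          (Eventually.of_forall fun ξ => ?_)
      simp only [SchwartzMap.smulLeftCLM_apply_apply (coord_temperate i), map_smul,
        PiLp.proj_apply, smul_eq_mul]
      ring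
    simp only [e, ← Finset.mul_sum]
    rw [← integral_finsetSum _ fun i _ => ei i]
    simp only [← Finset.smul_sum]
  have hloc : LocallyIntegrable fun ξ : Pt => (jw (-t) ξ : ℂ) • ∑ i, (ξ i : ℂ) * G ξ i := by
    have hG (i : Fin 3) : LocallyIntegrable fun ξ : Pt => G ξ i := by
      have := ((Lp.memLp G).continuousLinearMap_comp (EuclideanSpace.proj i : Vec →L[ℂ] ℂ))
      exact this.locallyIntegrable (by norm_num)
    have h2 : LocallyIntegrable fun ξ : Pt => ∑ i, (ξ i : ℂ) * G ξ i := by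
      have h3 (i : Fin 3) : LocallyIntegrable fun ξ : Pt => (ξ i : ℂ) * G ξ i :=
        (hG i).continuous_smul (show Continuous fun ξ : Pt => (ξ i : ℂ) by fun_prop)
      simp only [Fin.sum_univ_three]
      exact ((h3 0).add (h3 1)).add (h3 2)
    exact h2.continuous_smul (Complex.continuous_ofReal.comp (jw_continuous _))
  constructor
  · intro h
    have h0 := ae_eq_zero_of_schwartz hloc fun ψ => by
      have h1 := h (𝓕 ψ)
      rw [key] at h1
      simpa [Real.pi_ne_zero] using h1
    filter_upwards [h0] with ξ hξ
    simpa [(jw_pos (-t) ξ).ne'] using hξ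
  · intro h ψ
    have h1 := key (𝓕⁻ ψ)
    rw [fourier_fourierInv_eq] at h1
    rw [h1, integral_eq_zero_of_ae, mul_zero]
    filter_upwards [h] with ξ hξ
    simp [hξ]

/-! ### Singular kernels and their symbols -/

/-- The factor `min(1,|z|)^k` lowers the singularity at the origin to order `3 + a - k < 3`; at
infinity the decay `3 + a > 3` suffices. -/
theorem integrable_rpow_mul_min_pow {a : ℝ} {k : ℕ} (ha : 0 < a) (hak : a < k) :
    Integrable fun z : Pt => ‖z‖ ^ (-(3 + a)) * (min 1 ‖z‖) ^ k := by
  have hmeas : Measurable fun z : Pt => ‖z‖ ^ (-(3 + a)) * (min 1 ‖z‖) ^ k := by fun_prop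
  rw [← integrableOn_univ, ← Set.union_compl_self (Metric.ball (0 : Pt) 1)]
  refine IntegrableOn.union ?_ ?_
  · refine (integrableOn_ball_of_norm_le_rpow (C := 1) (α := 3 + a - k) (by simp) (by simp; linarith)
      (Eventually.of_forall fun z => ?_) hmeas.aestronglyMeasurable)
    rw [Real.norm_of_nonneg (by positivity), one_mul]
    rcases (norm_nonneg z).eq_or_lt with h0 | h0
    · rw [← h0]
      have : k ≠ 0 := by rintro rfl; simp at hak; linarith
      simp [this]; positivity
    · calc ‖z‖ ^ (-(3 + a)) * (min 1 ‖z‖) ^ k ≤ ‖z‖ ^ (-(3 + a)) * ‖z‖ ^ k := by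
            gcongr; exact min_le_right _ _
        _ = _ := by
            rw [← Real.rpow_natCast, ← Real.rpow_add h0]; congr 1; ring
  -- The constant `2^(3+a)` comes from `1 + ‖z‖ ≤ 2‖z‖` outside the unit ball.
  · have hi := (integrable_one_add_norm (E := Pt) (μ := volume) (r := 3 + a) (by simp; linarith)).const_mul
      ((2 : ℝ) ^ (3 + a))
    refine hi.integrableOn.mono' hmeas.aestronglyMeasurable ?_
    refine ae_restrict_of_forall_mem measurableSet_ball.compl fun z hz => ?_
    have hz1 : 1 ≤ ‖z‖ := by simpa using hz
    rw [Real.norm_of_nonneg (by positivity), min_eq_left hz1, one_pow, mul_one,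
      Real.rpow_neg (by positivity), Real.rpow_neg (by positivity), ← div_eq_mul_inv,
      ← Real.inv_rpow (by positivity), ← Real.div_rpow (by positivity) (by positivity)]
    refine Real.rpow_le_rpow (by positivity) ?_ (by linarith)
    rw [inv_eq_one_div, div_le_div_iff₀ (by positivity) (by positivity)]
    linarith

/-- The character `e^{2πi z·ξ}`. -/
noncomputable def ee (z ξ : Pt) : ℂ := (Real.fourierChar (inner ℝ z ξ) : ℂ)

theorem norm_ee (z ξ : Pt) : ‖ee z ξ‖ = 1 := Circle.norm_coe _

theorem ee_add (z z' ξ : Pt) : ee (z + z') ξ = ee z ξ * ee z' ξ := by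
  simp [ee, inner_add_left, AddChar.map_add_eq_mul]

@[simp] theorem ee_zero_right (z : Pt) : ee z 0 = 1 := by simp [ee]

theorem ee_continuous : Continuous fun p : Pt × Pt => ee p.1 p.2 := by
  unfold ee
  exact continuous_subtype_val.comp (Real.continuous_fourierChar.comp continuous_inner)

theorem ee_continuous_right (z : Pt) : Continuous fun ξ => ee z ξ :=
  ee_continuous.comp (Continuous.prodMk_right z)

theorem norm_ee_sub_one_le (z ξ : Pt) :
    ‖ee z ξ - 1‖ ≤ 2 * Real.pi * (1 + ‖ξ‖) * min 1 ‖z‖ := by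
  have hpi := Real.two_le_pi
  rcases le_total 1 ‖z‖ with h | h
  · rw [min_eq_left h]
    calc ‖ee z ξ - 1‖ ≤ ‖ee z ξ‖ + ‖(1 : ℂ)‖ := norm_sub_le _ _
      _ = 2 := by rw [norm_ee]; norm_num
      _ ≤ _ := by nlinarith [norm_nonneg ξ]
  · rw [min_eq_right h]
    have e : ee z ξ = Complex.exp (Complex.I * ((2 * Real.pi * inner ℝ z ξ : ℝ) : ℂ)) := by
      simp [ee, Real.fourierChar_apply, mul_comm]
    rw [e]
    refine Real.norm_exp_I_mul_ofReal_sub_one_le.trans ?_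
    rw [norm_mul, Real.norm_of_nonneg (by positivity), mul_assoc (2 * Real.pi)]
    gcongr
    exact (abs_real_inner_le_norm z ξ).trans (by nlinarith [norm_nonneg z, norm_nonneg ξ])

/-- The symbol `ξ ↦ ∫ g(e^{2πi z·ξ}) k(z) dz`. -/
noncomputable def symb {F : Type} [NormedAddCommGroup F] [NormedSpace ℂ F] (g : ℂ → ℂ) (k : Pt → F)
    (ξ : Pt) : F := ∫ z, g (ee z ξ) • k z

section Symb
variable {F : Type} [NormedAddCommGroup F] [NormedSpace ℂ F]

/-- Substitute `t • z` for `z`: the Jacobian `t³` and the homogeneity of the kernel leave the factor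
`t^a`. -/
theorem symb_smul (g : ℂ → ℂ) {k : Pt → F} {a t : ℝ} (ht : 0 < t)
    (hk : ∀ z, k (t • z) = (t ^ (-(3 + a)) : ℝ) • k z) (ξ : Pt) :
    symb g k (t • ξ) = (t ^ a : ℝ) • symb g k ξ := by
  have h := Measure.integral_comp_smul (μ := (volume : Measure Pt)) (fun z => g (ee z ξ) • k z) t
  have e (z : Pt) : g (ee (t • z) ξ) • k (t • z) =
      (t ^ (-(3 + a)) : ℝ) • (g (ee z (t • ξ)) • k z) := by
    rw [hk, smul_comm]
    simp [ee, inner_smul_left, inner_smul_right]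
  simp only [e] at h
  rw [integral_smul] at h
  have h2 := congrArg ((t ^ (3 + a) : ℝ) • ·) h
  simp only [smul_smul] at h2
  rw [← Real.rpow_add ht, add_neg_cancel, Real.rpow_zero, one_smul] at h2
  unfold symb
  rw [h2]
  congr 1
  simp only [finrank_euclideanSpace, Fintype.card_fin]
  rw [abs_of_pos (by positivity), Real.rpow_add ht]
  norm_cast
  field_simp

/-- By homogeneity a bound on the unit sphere propagates as `B |ξ|^a`. This improves on the direct
estimate `(1 + |ξ|)^j`, which would cost too many derivatives. -/
theorem symb_bound_of_ball {g : ℂ → ℂ} {k : Pt → F} {a : ℝ} (ha : 0 ≤ a)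
    (hk : ∀ t : ℝ, 0 < t → ∀ z, k (t • z) = (t ^ (-(3 + a)) : ℝ) • k z) {B : ℝ}
    (hB : ∀ ξ, ‖ξ‖ ≤ 1 → ‖symb g k ξ‖ ≤ B) (ξ : Pt) : ‖symb g k ξ‖ ≤ B * jw a ξ := by
  rcases eq_or_ne ξ 0 with rfl | h0
  · simpa [jw] using hB 0 (by simp)
  have hp : 0 < ‖ξ‖ := norm_pos_iff.2 h0
  have hB0 : 0 ≤ B := (norm_nonneg _).trans (hB 0 (by simp))
  have e : ξ = ‖ξ‖ • (‖ξ‖⁻¹ • ξ) := by rw [smul_smul, mul_inv_cancel₀ hp.ne', one_smul]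
  have h1 : ‖symb g k (‖ξ‖⁻¹ • ξ)‖ ≤ B := hB _ (by rw [norm_smul]; simp [hp.ne'])
  have h2 : ‖ξ‖ ^ a ≤ jw a ξ := by
    have : ‖ξ‖ ^ a = (‖ξ‖ ^ 2) ^ (a / 2) := by
      rw [← Real.rpow_natCast, ← Real.rpow_mul hp.le]; congr 1; push_cast; ring
    rw [this, jw]
    gcongr
    linarith
  calc ‖symb g k ξ‖ = ‖ξ‖ ^ a * ‖symb g k (‖ξ‖⁻¹ • ξ)‖ := by
        conv_lhs => rw [e, symb_smul g hp (hk _ hp), norm_smul, Real.norm_of_nonneg (by positivity)]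
    _ ≤ ‖ξ‖ ^ a * B := by gcongr
    _ ≤ jw a ξ * B := by gcongr
    _ = _ := mul_comm _ _

/-- The kernel `k` is integrable with the weight `min(1,|z|)^j`. -/
def KerInt (j : ℕ) (k : Pt → F) : Prop := Integrable fun z => (min 1 ‖z‖) ^ j • k z

theorem kerInt_of_le {j : ℕ} {k : Pt → F} {a C : ℝ} (hm : AEStronglyMeasurable k) (ha : 0 < a)
    (haj : a < j) (hk : ∀ z, ‖k z‖ ≤ C * ‖z‖ ^ (-(3 + a))) : KerInt j k := by
  refine ((integrable_rpow_mul_min_pow ha haj).const_mul C).mono'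
    ((by fun_prop : Measurable fun z : Pt => (min 1 ‖z‖) ^ j).aestronglyMeasurable.smul hm)
    (Eventually.of_forall fun z => ?_)
  simp only [norm_smul, norm_pow, Real.norm_eq_abs]
  rw [abs_of_nonneg (by positivity : 0 ≤ min 1 ‖z‖), ← mul_assoc, mul_comm]
  gcongr
  exact hk z

/-- The weight is positive off the origin, so it can be divided out almost everywhere. -/
theorem KerInt.aesm {j : ℕ} {k : Pt → F} (hk : KerInt j k) : AEStronglyMeasurable k := by
  have h := (by fun_prop : Measurable fun z : Pt =>
    ((min 1 ‖z‖) ^ j)⁻¹).aestronglyMeasurable (μ := volume) |>.smul hk.1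
  refine h.congr ?_
  have h0 : ∀ᵐ z : Pt, z ≠ 0 := by simp [ae_iff]
  filter_upwards [h0] with z hz
  have : 0 < min 1 ‖z‖ := lt_min one_pos (norm_pos_iff.2 hz)
  simp only [Pi.smul_apply', smul_smul]
  rw [inv_mul_cancel₀ (by positivity), one_smul]

theorem KerInt.integrand {j : ℕ} {k : Pt → F} (hk : KerInt j k) {g : ℂ → ℂ} (hg : Continuous g)
    (hgb : ∀ w, ‖g w‖ ≤ ‖w - 1‖ ^ j) (ξ : Pt) : Integrable fun z => g (ee z ξ) • k z := by
  refine (hk.norm.const_mul ((2 * Real.pi * (1 + ‖ξ‖)) ^ j)).mono' ?_ (Eventually.of_forall fun z => ?_)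
  · exact (hg.comp (ee_continuous.comp (by fun_prop : Continuous fun z : Pt => (z, ξ)))).aestronglyMeasurable.smul
      hk.aesm
  · simp only [norm_smul, norm_pow, Real.norm_eq_abs]
    rw [abs_of_nonneg (by positivity : 0 ≤ min 1 ‖z‖), ← mul_assoc, ← mul_pow]
    gcongr
    exact (hgb _).trans (by gcongr; exact norm_ee_sub_one_le z ξ)

theorem KerInt.norm_symb_le {j : ℕ} {k : Pt → F} (hk : KerInt j k) {g : ℂ → ℂ}
    (hgb : ∀ w, ‖g w‖ ≤ ‖w - 1‖ ^ j) (ξ : Pt) :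
    ‖symb g k ξ‖ ≤ (2 * Real.pi * (1 + ‖ξ‖)) ^ j * ∫ z, ‖(min 1 ‖z‖) ^ j • k z‖ := by
  rw [symb, ← integral_const_mul]
  refine norm_integral_le_of_norm_le (hk.norm.const_mul _) (Eventually.of_forall fun z => ?_)
  simp only [norm_smul, norm_pow, Real.norm_eq_abs]
  rw [abs_of_nonneg (by positivity : 0 ≤ min 1 ‖z‖), ← mul_assoc, ← mul_pow]
  gcongr
  exact (hgb _).trans (by gcongr; exact norm_ee_sub_one_le z ξ)

theorem KerInt.exists_symb_bound {j : ℕ} {k : Pt → F} (hk : KerInt j k) {g : ℂ → ℂ}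
    (hgb : ∀ w, ‖g w‖ ≤ ‖w - 1‖ ^ j) {a : ℝ} (ha : 0 ≤ a)
    (hkh : ∀ t : ℝ, 0 < t → ∀ z, k (t • z) = (t ^ (-(3 + a)) : ℝ) • k z) :
    ∃ B, ∀ ξ, ‖symb g k ξ‖ ≤ B * jw a ξ := by
  refine ⟨(2 * Real.pi * 2) ^ j * ∫ z, ‖(min 1 ‖z‖) ^ j • k z‖,
    symb_bound_of_ball ha hkh fun ξ hξ => (hk.norm_symb_le hgb ξ).trans ?_⟩
  gcongr
  linarith

theorem KerInt.symb_aesm {j : ℕ} {k : Pt → F} (hk : KerInt j k) {g : ℂ → ℂ} (hg : Continuous g) :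
    AEStronglyMeasurable (symb g k) := by
  have h : AEStronglyMeasurable (fun p : Pt × Pt => g (ee p.2 p.1) • k p.2)
      ((volume : Measure Pt).prod volume) := by
    refine AEStronglyMeasurable.smul ?_ hk.aesm.comp_snd
    exact (hg.comp (ee_continuous.comp continuous_swap)).aestronglyMeasurable
  exact h.integral_prod_right'

end Symb

/-! ### Nonlocal difference operators as Fourier multipliers -/

section Nonlocal
variable {F F' : Type} [NormedAddCommGroup F] [InnerProductSpace ℂ F] [CompleteSpace F]
  [NormedAddCommGroup F'] [InnerProductSpace ℂ F'] [CompleteSpace F']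

theorem exists_bilin_bound (L : Vec →L[ℂ] F →L[ℂ] F') :
    ∃ C, 0 ≤ C ∧ ∀ u v, ‖L u v‖ ≤ C * ‖u‖ * ‖v‖ :=
  ⟨‖L‖, L.opNorm_nonneg, L.le_opNorm₂⟩

theorem schwartz_sub_eq (w : 𝓢(Pt, F)) (x z : Pt) :
    w (x + z) - w x = ∫ ξ, (ee x ξ * (ee z ξ - 1)) • 𝓕 w ξ := by
  have e (y : Pt) : w y = ∫ ξ, ee y ξ • 𝓕 w ξ := by
    have h := congrArg (fun u : 𝓢(Pt, F) => u y)
      (fourierInv_fourier_eq (F := 𝓢(Pt, F)) w)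
    simp only [SchwartzMap.fourierInv_coe, Real.fourierInv_eq] at h
    refine h.symm.trans ?_
    refine integral_congr_ae (Eventually.of_forall fun ξ => ?_)
    simp only [ee, real_inner_comm, Circle.smul_def]
  have ei (y : Pt) : Integrable fun ξ => ee y ξ • 𝓕 w ξ := by
    refine (𝓕 w).integrable.bdd_smul 1 ?_ (Eventually.of_forall fun ξ => (norm_ee y ξ).le)
    exact (ee_continuous_right y).aestronglyMeasurable
  rw [e, e, ← integral_sub (ei _) (ei _)]
  refine integral_congr_ae (Eventually.of_forall fun ξ => ?_)
  simp only [ee_add, ← sub_smul, mul_sub, mul_one]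

theorem integrable_weight_fourier (w : 𝓢(Pt, F)) (j : ℕ) :
    Integrable fun ξ => (1 + ‖ξ‖) ^ j * ‖𝓕 w ξ‖ := by
  simp only [add_pow, one_pow, one_mul, Finset.sum_mul]
  refine integrable_finsetSum _ fun i _ => ?_
  refine (((𝓕 w).integrable_pow_mul volume (j - i)).const_mul (j.choose i : ℝ)).congr
    (Eventually.of_forall fun ξ => ?_)
  simp only; ring

/-- Write the increment of `w` by Fourier inversion and exchange the integrals. Absolute convergence
comes from `|e^{2πi z·ξ} - 1| ≤ 2π (1 + |ξ|) min(1,|z|)`: one factor tames the kernel, the other is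
absorbed by the decay of `𝓕 w`. -/
theorem nonlocal_integrable_and_eq (L : Vec →L[ℂ] F →L[ℂ] F') {k : Pt → Vec} (hk : KerInt 1 k)
    (w : 𝓢(Pt, F)) (x : Pt) :
    (Integrable fun z => L (k z) (w (x + z) - w x)) ∧ ∫ z, L (k z) (w (x + z) - w x) =
      𝓕⁻ (fun ξ => L (symb (fun v => v - 1) k ξ) (𝓕 w ξ)) x := by
  have hsub := schwartz_sub_eq w
  have hwt := integrable_weight_fourier w 1
  obtain ⟨C, hC0, hC⟩ := exists_bilin_bound L
  generalize (𝓕 w : 𝓢(Pt, F)) = η at hsub hwt ⊢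
  have hint : Integrable (fun p : Pt × Pt => L (k p.1) ((ee x p.2 * (ee p.1 p.2 - 1)) • η p.2))
      ((volume : Measure Pt).prod volume) := by
    have h1 := (hk.norm.mul_prod hwt).const_mul (C * (2 * Real.pi))
    refine h1.mono' ?_ (Eventually.of_forall fun p => ?_)
    · have hc : AEStronglyMeasurable (fun p : Pt × Pt => (k p.1, (ee x p.2 * (ee p.1 p.2 - 1)) • η p.2))
          ((volume : Measure Pt).prod volume) := by
        refine hk.aesm.comp_fst.prodMk (AEStronglyMeasurable.smul ?_ ?_)
        · refine Continuous.aestronglyMeasurable ?_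
          have h1 : Continuous fun p : Pt × Pt => ee x p.2 :=
            ee_continuous.comp (by fun_prop : Continuous fun p : Pt × Pt => (x, p.2))
          exact h1.mul (ee_continuous.sub continuous_const)
        · exact ((η).continuous.comp continuous_snd).aestronglyMeasurable
      exact L.continuous₂.comp_aestronglyMeasurable hc
    · refine (hC _ _).trans ?_
      simp only [norm_smul, norm_mul, norm_ee, one_mul, pow_one, Real.norm_eq_abs]
      rw [abs_of_nonneg (by positivity : 0 ≤ min 1 ‖p.1‖)]
      calc C * ‖k p.1‖ * (‖ee p.1 p.2 - 1‖ * ‖η p.2‖)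
          ≤ C * ‖k p.1‖ * ((2 * Real.pi * (1 + ‖p.2‖) * min 1 ‖p.1‖) * ‖η p.2‖) := by
            exact mul_le_mul_of_nonneg_left (mul_le_mul_of_nonneg_right
              (norm_ee_sub_one_le p.1 p.2) (norm_nonneg _))
              (mul_nonneg hC0 (norm_nonneg _))
        _ = _ := by ring
  have hpt (z : Pt) : L (k z) (w (x + z) - w x) =
      ∫ ξ, L (k z) ((ee x ξ * (ee z ξ - 1)) • η ξ) := by
    rw [hsub]
    refine ((L (k z)).integral_comp_comm ?_).symm
    refine (hwt.const_mul (2 * Real.pi * min 1 ‖z‖)).mono' ?_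
      (Eventually.of_forall fun ξ => ?_)
    · refine AEStronglyMeasurable.smul ?_ (η).continuous.aestronglyMeasurable
      refine Continuous.aestronglyMeasurable ?_
      exact (ee_continuous_right x).mul ((ee_continuous_right z).sub continuous_const)
    · simp only [norm_smul, norm_mul, norm_ee, one_mul, pow_one]
      refine (mul_le_mul_of_nonneg_right (norm_ee_sub_one_le z ξ) (norm_nonneg _)).trans_eq ?_
      ring
  simp only [hpt]
  refine ⟨hint.integral_prod_left, ?_⟩
  calc ∫ z, ∫ ξ, L (k z) ((ee x ξ * (ee z ξ - 1)) • η ξ)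
      = ∫ ξ, ∫ z, L (k z) ((ee x ξ * (ee z ξ - 1)) • η ξ) := integral_integral_swap hint
    _ = _ := by
        rw [Real.fourierInv_eq]
        refine integral_congr_ae (Eventually.of_forall fun ξ => ?_)
        have hi := hk.integrand (g := fun v => v - 1) (by fun_prop) (by simp) ξ
        simp only [symb, Circle.smul_def, real_inner_comm]
        have e2 := ((L.flip (η ξ)).integral_comp_comm hi)
        simp only [ContinuousLinearMap.flip_apply] at e2
        rw [← e2, ← integral_smul]
        refine integral_congr_ae (Eventually.of_forall fun z => ?_)
        simp only [map_smul, smul_apply, smul_smul]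
        rfl

theorem integrable_symb_fourier (L : Vec →L[ℂ] F →L[ℂ] F') {k : Pt → Vec} (hk : KerInt 1 k)
    (w : 𝓢(Pt, F)) : Integrable fun ξ => L (symb (fun v => v - 1) k ξ) (𝓕 w ξ) := by
  have hwt := integrable_weight_fourier w 1
  obtain ⟨C, hC0, hC⟩ := exists_bilin_bound L
  generalize (𝓕 w : 𝓢(Pt, F)) = η at hwt ⊢
  refine (hwt.const_mul
    (C * (2 * Real.pi) * ∫ z, ‖(min 1 ‖z‖) ^ 1 • k z‖)).mono' ?_ (Eventually.of_forall fun ξ => ?_)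
  · have hc : AEStronglyMeasurable fun ξ : Pt => (symb (fun v => v - 1) k ξ, η ξ) :=
      (hk.symb_aesm (by fun_prop)).prodMk η.continuous.aestronglyMeasurable
    exact L.continuous₂.comp_aestronglyMeasurable hc
  · refine (hC _ _).trans ?_
    calc C * ‖symb (fun v => v - 1) k ξ‖ * ‖η ξ‖
        ≤ C * ((2 * Real.pi * (1 + ‖ξ‖)) ^ 1 * ∫ z, ‖(min 1 ‖z‖) ^ 1 • k z‖) * ‖η ξ‖ := by
          exact mul_le_mul_of_nonneg_right (mul_le_mul_of_nonneg_left
            (hk.norm_symb_le (g := fun v => v - 1) (by simp) ξ) hC0) (norm_nonneg _)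
      _ = _ := by ring

end Nonlocal

/-! ### The vector symbol: direction and nonvanishing -/

/-- The complexification of a real vector. -/
noncomputable def cplx (b : Pt) : Vec := WithLp.toLp 2 fun i => (b i : ℂ)

/-- The radial factor of the kernel of `Π𝒞*`. -/
noncomputable def rho (κ s : ℝ) (z : Pt) : ℝ :=
  √κ / √2 / (‖z‖ ^ ((3 : ℝ) / 2) * ‖z‖ ^ ((3 : ℝ) / 2 + s + 1))

/-- The kernel `|z|^{-3/2} α(0,z)` of `Π𝒞*`. -/
noncomputable def kern (κ s : ℝ) (z : Pt) : Vec := (rho κ s z : ℂ) • cplx z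

theorem inv_smul_alpha (κ s : ℝ) (x y : Pt) :
    (‖x - y‖ ^ ((3 : ℝ) / 2))⁻¹ • alpha κ s x y = kern κ s (y - x) := by
  ext i
  simp only [alpha, kern, rho, cplx, PiLp.smul_apply, smul_eq_mul, norm_sub_rev x y,
    Complex.real_smul, PiLp.sub_apply]
  push_cast
  field_simp

theorem rho_mul_norm (κ : ℝ) {s : ℝ} (hs : 0 < s) (z : Pt) :
    rho κ s z * ‖z‖ = √κ / √2 * ‖z‖ ^ (-(3 + s)) := by
  rcases (norm_nonneg z).eq_or_lt with h0 | h0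
  -- At the origin the negative power takes its default value `0`, matching the left side.
  · rw [← h0, Real.zero_rpow (by linarith)]; simp
  · rw [rho, ← Real.rpow_add h0, Real.rpow_neg h0.le,
      show (3 : ℝ) / 2 + (3 / 2 + s + 1) = (3 + s) + 1 by ring, Real.rpow_add_one h0.ne']
    field_simp

theorem rho_nonneg (κ s : ℝ) (z : Pt) : 0 ≤ rho κ s z := by unfold rho; positivity

theorem norm_cplx (b : Pt) : ‖cplx b‖ = ‖b‖ := by
  simp [EuclideanSpace.norm_eq, cplx]

theorem cplx_continuous : Continuous cplx := by
  unfold cplx; fun_prop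

theorem rho_measurable (κ s : ℝ) : Measurable (rho κ s) := by
  unfold rho; fun_prop

theorem rho_smul (κ s : ℝ) {t : ℝ} (ht : 0 < t) (z : Pt) :
    rho κ s (t • z) = t ^ (-(3 + s) - 1) * rho κ s z := by
  unfold rho
  rw [norm_smul, Real.norm_of_nonneg ht.le, Real.mul_rpow ht.le (norm_nonneg _),
    Real.mul_rpow ht.le (norm_nonneg _), show -(3 + s) - 1 = -(3 / 2 + (3 / 2 + s + 1)) by ring,
    Real.rpow_neg ht.le, Real.rpow_add ht (3 / 2) (3 / 2 + s + 1)]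
  generalize t ^ (3 / 2 : ℝ) = a
  generalize t ^ (3 / 2 + s + 1) = b
  field_simp

theorem kern_kerInt (κ : ℝ) (s : Set.Ioo (0 : ℝ) 1) : KerInt 1 (kern κ s) := by
  refine kerInt_of_le (a := s) (C := √κ / √2) ?_ s.2.1 (by simpa using s.2.2) fun z => ?_
  · exact ((Complex.measurable_ofReal.comp (rho_measurable κ s)).aestronglyMeasurable).smul
      cplx_continuous.aestronglyMeasurable
  · rw [kern, norm_smul, norm_cplx, Complex.norm_real, Real.norm_of_nonneg (rho_nonneg _ _ _),
      rho_mul_norm κ s.2.1]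

theorem kern_smul (κ s : ℝ) (t : ℝ) (ht : 0 < t) (z : Pt) :
    kern κ s (t • z) = (t ^ (-(3 + s)) : ℝ) • kern κ s z := by
  have h : t ^ (-(3 + s)) = t ^ (-(3 + s) - 1) * t := by
    rw [← Real.rpow_add_one ht.ne']; congr 1; ring
  ext i
  simp only [kern, rho_smul κ s ht, cplx, PiLp.smul_apply, smul_eq_mul, Complex.real_smul, h]
  push_cast
  ring

/-- The Fourier symbol of the vector kernel. -/
noncomputable def msym (κ s : ℝ) : Pt → Vec := symb (fun v => v - 1) (kern κ s)

theorem msym_bound (κ : ℝ) (s : Set.Ioo (0 : ℝ) 1) : ∃ B, ∀ ξ, ‖msym κ s ξ‖ ≤ B * jw s ξ :=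
  (kern_kerInt κ s).exists_symb_bound (by simp) s.2.1.le (kern_smul κ s)

theorem msym_aesm (κ : ℝ) (s : Set.Ioo (0 : ℝ) 1) : AEStronglyMeasurable (msym κ s) :=
  (kern_kerInt κ s).symb_aesm (by fun_prop)

theorem dot_cplx_msym (κ : ℝ) (s : Set.Ioo (0 : ℝ) 1) (b ξ : Pt) :
    dot (cplx b) (msym κ s ξ) =
      ∫ z, (ee z ξ - 1) * ((rho κ s z * inner ℝ z b : ℝ) : ℂ) := by
  have h := (dotL (cplx b)).integral_comp_comm
    ((kern_kerInt κ s).integrand (g := fun v => v - 1) (by fun_prop) (by simp) ξ)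
  refine h.symm.trans (integral_congr_ae (Eventually.of_forall fun z => ?_))
  simp only [map_smul, dotL_apply, kern, smul_eq_mul]
  congr 1
  simp only [dot, cplx, PiLp.inner_apply, RCLike.inner_apply, conj_trivial, Complex.ofReal_mul,
    Complex.ofReal_sum]

/-- The kernel is a radial function times `z`, and `R` preserves volume and inner products, so `z ↦
R z` is a legitimate substitution in the integral. -/
theorem dot_cplx_msym_isometry (κ : ℝ) (s : Set.Ioo (0 : ℝ) 1) (R : Pt ≃ₗᵢ[ℝ] Pt) (b ξ : Pt) :
    dot (cplx (R b)) (msym κ s (R ξ)) = dot (cplx b) (msym κ s ξ) := by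
  rw [dot_cplx_msym, dot_cplx_msym, ← R.measurePreserving.integral_comp
    R.toHomeomorph.measurableEmbedding]
  simp [ee, rho]

theorem dot_cplx_msym_smul (κ : ℝ) (s : Set.Ioo (0 : ℝ) 1) {t : ℝ} (ht : 0 < t) (b ξ : Pt) :
    dot (cplx b) (msym κ s (t • ξ)) = (t ^ (s : ℝ) : ℝ) * dot (cplx b) (msym κ s ξ) := by
  rw [msym, symb_smul _ ht (kern_smul κ s t ht)]
  simp only [dot, PiLp.smul_apply, Finset.mul_sum, Complex.real_smul]
  refine Finset.sum_congr rfl fun i _ => by ring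

/-- Reflection in the plane orthogonal to `b` fixes `ξ` and reverses `b`, so the component equals
its own negative. -/
theorem dot_cplx_msym_of_inner_eq_zero (κ : ℝ) (s : Set.Ioo (0 : ℝ) 1) {b ξ : Pt}
    (h : inner ℝ b ξ = 0) : dot (cplx b) (msym κ s ξ) = 0 := by
  have e := dot_cplx_msym_isometry κ s (Submodule.reflection (ℝ ∙ b)ᗮ) b ξ
  rw [Submodule.reflection_orthogonalComplement_singleton_eq_neg,
    Submodule.reflection_mem_subspace_eq_self (Submodule.mem_orthogonal_singleton_iff_inner_right.2 h)] at e
  have e2 : dot (cplx (-b)) (msym κ s ξ) = -dot (cplx b) (msym κ s ξ) := by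
    simp [dot, cplx]
  rw [e2] at e
  linear_combination (-1 / 2) * e

theorem msym_coord (κ : ℝ) (s : Set.Ioo (0 : ℝ) 1) (ξ : Pt) (i j : Fin 3) :
    (ξ j : ℂ) * msym κ s ξ i = ξ i * msym κ s ξ j := by
  have h := dot_cplx_msym_of_inner_eq_zero κ s (ξ := ξ)
    -- These vectors are orthogonal to `ξ`; vanishing of the symbol against them is its parallelism
    -- to `ξ` in coordinates.
    (b := ξ j • EuclideanSpace.single i (1 : ℝ) - ξ i • EuclideanSpace.single j (1 : ℝ)) (by
      simp [inner_sub_left, inner_smul_left, EuclideanSpace.inner_single_left, mul_comm])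
  have h2 : dot (cplx (ξ j • EuclideanSpace.single i (1 : ℝ) - ξ i • EuclideanSpace.single j (1 : ℝ)))
      (msym κ s ξ) = ξ j * msym κ s ξ i - ξ i * msym κ s ξ j := by
    simp [dot, cplx, sub_mul, Finset.sum_sub_distrib, apply_ite Complex.ofReal, ite_mul]
  rw [h2] at h
  exact sub_eq_zero.1 h

theorem normSq_smul_msym (κ : ℝ) (s : Set.Ioo (0 : ℝ) 1) (ξ : Pt) :
    ((‖ξ‖ ^ 2 : ℝ) : ℂ) • msym κ s ξ = dot (cplx ξ) (msym κ s ξ) • cplx ξ := by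
  ext i
  have h : ((‖ξ‖ ^ 2 : ℝ) : ℂ) = ∑ j, (ξ j : ℂ) * ξ j := by
    rw [EuclideanSpace.norm_sq_eq]
    push_cast
    simp only [Real.norm_eq_abs]
    refine Finset.sum_congr rfl fun j _ => ?_
    rw [← Complex.ofReal_pow, sq_abs]; push_cast; ring
  simp only [PiLp.smul_apply, smul_eq_mul, h, dot, cplx, Finset.sum_mul]
  refine Finset.sum_congr rfl fun j _ => ?_
  rw [mul_assoc, msym_coord κ s ξ i j]
  ring

/-- A dilation followed by a reflection carries `ξ₀` to any nonzero `ξ`, so the radial component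
vanishes everywhere; parallelism leaves no other component. -/
theorem msym_zero_of_dot_eq_zero (κ : ℝ) (s : Set.Ioo (0 : ℝ) 1) {ξ₀ : Pt} (h0 : ξ₀ ≠ 0)
    (h : dot (cplx ξ₀) (msym κ s ξ₀) = 0) (ξ : Pt) : msym κ s ξ = 0 := by
  rcases eq_or_ne ξ 0 with rfl | hξ
  · simp [msym, symb]
  have hp0 : 0 < ‖ξ₀‖ := norm_pos_iff.2 h0
  have hp : 0 < ‖ξ‖ := norm_pos_iff.2 hξ
  set t := ‖ξ‖ / ‖ξ₀‖ with ht
  have htp : 0 < t := by positivity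
  have hn : ‖t • ξ₀‖ = ‖ξ‖ := by
    rw [norm_smul, Real.norm_of_nonneg htp.le, ht]; field_simp
  have hR := Submodule.reflection_sub hn
  set R := Submodule.reflection (ℝ ∙ (t • ξ₀ - ξ))ᗮ
  have e : dot (cplx ξ) (msym κ s ξ) = 0 := by
    rw [← hR, dot_cplx_msym_isometry, dot_cplx_msym_smul κ s htp]
    have e2 : dot (cplx (t • ξ₀)) (msym κ s ξ₀) = t * dot (cplx ξ₀) (msym κ s ξ₀) := by
      simp [dot, cplx, Finset.mul_sum, mul_assoc]
    rw [e2, h]; simp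
  have h2 := normSq_smul_msym κ s ξ
  rw [e, zero_smul, smul_eq_zero] at h2
  refine h2.resolve_left ?_
  norm_cast
  positivity

/-- Otherwise the whole symbol vanishes, and with it the nonlocal operator. Evaluated at the origin
on `χ(z) z₀`, with a bump `χ`, the first component of that operator is `∫ χ ρ z₀²`, which is
positive. -/
theorem dot_cplx_msym_ne_zero {κ : ℝ} (hκ : 0 < κ) (s : Set.Ioo (0 : ℝ) 1) {ξ₀ : Pt} (h0 : ξ₀ ≠ 0) :
    dot (cplx ξ₀) (msym κ s ξ₀) ≠ 0 := by
  intro h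
  have hz := msym_zero_of_dot_eq_zero κ s h0 h
  let χ : ContDiffBump (0 : Pt) := ⟨1, 2, by norm_num, by norm_num⟩
  have hw₁ : HasCompactSupport fun z : Pt => ((χ z * z 0 : ℝ) : ℂ) := by
    have h1 : HasCompactSupport fun z : Pt => χ z * z 0 := χ.hasCompactSupport.mul_right
    exact h1.comp_left (g := fun x : ℝ => (x : ℂ)) (by simp)
  have hw₂ : ContDiff ℝ ∞ fun z : Pt => ((χ z * z 0 : ℝ) : ℂ) := by
    have h1 : ContDiff ℝ ∞ fun z : Pt => χ z * z 0 := χ.contDiff.mul (by fun_prop)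
    exact Complex.ofRealCLM.contDiff.comp h1
  obtain ⟨hi, he⟩ := nonlocal_integrable_and_eq
    (ContinuousLinearMap.lsmul ℂ ℂ).flip (kern_kerInt κ s) (hw₁.toSchwartzMap hw₂) 0
  have e0 : ∫ z, (ContinuousLinearMap.lsmul ℂ ℂ).flip (kern κ s z)
      ((hw₁.toSchwartzMap hw₂) (0 + z) - (hw₁.toSchwartzMap hw₂) 0) = 0 := by
    rw [he, Real.fourierInv_eq]
    refine integral_eq_zero_of_ae (Eventually.of_forall fun ξ => ?_)
    have : symb (fun v => v - 1) (kern κ s) ξ = 0 := hz ξ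
    simp [this]
  have e1 := ((EuclideanSpace.proj (0 : Fin 3) : Vec →L[ℂ] ℂ)).integral_comp_comm hi
  have i1 := ((EuclideanSpace.proj (0 : Fin 3) : Vec →L[ℂ] ℂ)).integrable_comp hi
  rw [e0] at e1
  replace e1 := e1.trans (map_zero _)
  have e2 (z : Pt) : (EuclideanSpace.proj (0 : Fin 3) : Vec →L[ℂ] ℂ)
      ((ContinuousLinearMap.lsmul ℂ ℂ).flip (kern κ s z)
      ((hw₁.toSchwartzMap hw₂) (0 + z) - (hw₁.toSchwartzMap hw₂) 0)) =
      ((χ z * (rho κ s z * z 0 ^ 2) : ℝ) : ℂ) := by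
    simp [kern, cplx]
    ring
  simp only [e2] at e1 i1
  rw [integral_complex_ofReal] at e1
  have i2 : Integrable fun z : Pt => χ z * (rho κ s z * z 0 ^ 2) := by
    exact i1.re
  have hnn : ∀ z : Pt, 0 ≤ χ z * (rho κ s z * z 0 ^ 2) := fun z =>
    mul_nonneg χ.nonneg (mul_nonneg (rho_nonneg _ _ _) (sq_nonneg _))
  have hpos : 0 < ∫ z : Pt, χ z * (rho κ s z * z 0 ^ 2) := by
    rw [integral_pos_iff_support_of_nonneg hnn i2]
    have hopen : IsOpen {z : Pt | ‖z‖ < 1 ∧ z 0 ≠ 0} :=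
      (isOpen_lt continuous_norm continuous_const).inter (isOpen_ne_fun (by fun_prop) (by fun_prop))
    refine (hopen.measure_pos volume ⟨EuclideanSpace.single 0 (1 / 2 : ℝ), ?_, ?_⟩).trans_le
      (measure_mono fun z hz => ?_)
    · simp; norm_num
    · simp
    · have hz0 : z ≠ 0 := by rintro rfl; exact hz.2 rfl
      have h1 : χ z = 1 := χ.one_of_mem_closedBall (by simpa using hz.1.le)
      have h2 : 0 < rho κ s z := by
        have := norm_pos_iff.2 hz0
        unfold rho; positivity
      have h3 := hz.2
      rw [Function.mem_support, h1]
      positivity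
  have : (∫ z : Pt, χ z * (rho κ s z * z 0 ^ 2)) = 0 := by exact_mod_cast e1
  exact hpos.ne' this

theorem exists_msym_eq {κ : ℝ} (hκ : 0 < κ) (s : Set.Ioo (0 : ℝ) 1) {ξ : Pt} (h0 : ξ ≠ 0) :
    ∃ μ : ℂ, μ ≠ 0 ∧ msym κ s ξ = μ • cplx ξ := by
  have hp : ((‖ξ‖ ^ 2 : ℝ) : ℂ) ≠ 0 := by
    have := norm_pos_iff.2 h0
    norm_cast; positivity
  refine ⟨((‖ξ‖ ^ 2 : ℝ) : ℂ)⁻¹ * dot (cplx ξ) (msym κ s ξ),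
    mul_ne_zero (inv_ne_zero hp) (dot_cplx_msym_ne_zero hκ s h0), ?_⟩
  rw [mul_smul, ← normSq_smul_msym, smul_smul, inv_mul_cancel₀ hp, one_smul]

/-! ### The scalar symbol of the divergence of a gradient -/

/-- The kernel `|α(0,z)|²` of `𝒟𝒟*`. -/
noncomputable def kern2 (κ s : ℝ) (z : Pt) : ℂ := dot (alpha κ s 0 z) (alpha κ s 0 z)

theorem kern2_eq (κ : ℝ) {s : ℝ} (hs : 0 < s) (z : Pt) :
    kern2 κ s z = (((√κ / √2) ^ 2 * ‖z‖ ^ (-(3 + 2 * s)) : ℝ) : ℂ) := by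
  have e : kern2 κ s z = (((√κ / √2) ^ 2 * (‖z‖ ^ 2 / (‖z‖ ^ ((3 : ℝ) / 2 + s + 1)) ^ 2) : ℝ) : ℂ) := by
    rw [EuclideanSpace.norm_sq_eq]
    simp only [kern2, dot, alpha, sub_zero, Fin.sum_univ_three, Real.norm_eq_abs, sq_abs,
      PiLp.zero_apply]
    push_cast
    ring
  rw [e]
  congr 2
  rcases (norm_nonneg z).eq_or_lt with h0 | h0
  · rw [← h0, Real.zero_rpow (x := -(3 + 2 * s)) (by linarith)]; simp
  · rw [← Real.rpow_natCast, ← Real.rpow_natCast, ← Real.rpow_mul h0.le, ← Real.rpow_sub h0]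
    congr 1; push_cast; ring

theorem kern2_kerInt (κ : ℝ) (s : Set.Ioo (0 : ℝ) 1) : KerInt 2 (kern2 κ s) := by
  have h0 := s.2.1
  have h1 := s.2.2
  refine kerInt_of_le (a := 2 * s) (C := (√κ / √2) ^ 2) ?_ (by linarith)
    (by push_cast; linarith) fun z => ?_
  · simp only [funext (kern2_eq κ h0)]
    exact (by fun_prop : Measurable _).aestronglyMeasurable
  · rw [kern2_eq κ h0, Complex.norm_real, Real.norm_of_nonneg (by positivity)]

theorem kern2_smul (κ : ℝ) (s : Set.Ioo (0 : ℝ) 1) (t : ℝ) (ht : 0 < t) (z : Pt) :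
    kern2 κ s (t • z) = (t ^ (-(3 + 2 * (s : ℝ))) : ℝ) • kern2 κ s z := by
  rw [kern2_eq κ s.2.1, kern2_eq κ s.2.1, norm_smul, Real.norm_of_nonneg ht.le,
    Real.mul_rpow ht.le (norm_nonneg _), Complex.real_smul, ← Complex.ofReal_mul]
  congr 1; ring

/-- The Fourier symbol of `𝒟𝒟*`. -/
noncomputable def nsym (κ s : ℝ) : Pt → ℂ :=
  symb (fun v => ((‖v - 1‖ ^ 2 : ℝ) : ℂ)) (kern2 κ s)

theorem nsym_bound (κ : ℝ) (s : Set.Ioo (0 : ℝ) 1) :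
    ∃ B, ∀ ξ, ‖nsym κ s ξ‖ ≤ B * jw (2 * s) ξ :=
  (kern2_kerInt κ s).exists_symb_bound (by simp) (by have := s.2.1; linarith) (kern2_smul κ s)

theorem nsym_aesm (κ : ℝ) (s : Set.Ioo (0 : ℝ) 1) : AEStronglyMeasurable (nsym κ s) :=
  (kern2_kerInt κ s).symb_aesm (by fun_prop)

theorem weight_msym_memLp (κ : ℝ) (s : Set.Ioo (0 : ℝ) 1) :
    MemLp (fun ξ => (jw (-s) ξ : ℂ) • msym κ s ξ) ⊤ (volume : Measure Pt) := by
  obtain ⟨B, hB⟩ := msym_bound κ s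
  refine memLp_top_of_bound (C := B) ?_ (Eventually.of_forall fun ξ => ?_)
  · exact (Complex.continuous_ofReal.comp (jw_continuous _)).aestronglyMeasurable.smul (msym_aesm κ s)
  · rw [norm_smul, Complex.norm_real, Real.norm_of_nonneg (jw_pos _ _).le]
    calc jw (-s) ξ * ‖msym κ s ξ‖ ≤ jw (-s) ξ * (B * jw s ξ) :=
          mul_le_mul_of_nonneg_left (hB ξ) (jw_pos _ _).le
      _ = B * (jw (-s) ξ * jw s ξ) := by ring
      _ = B := by rw [jw_neg_mul, mul_one]

/-! ### Bounded multipliers and the extensions by density -/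

section MulOp
variable {F : Type} [NormedAddCommGroup F] [InnerProductSpace ℂ F] [CompleteSpace F]

/-- Multiplication by the normalised symbol on `L²`. -/
noncomputable def mulOp (κ : ℝ) (s : Set.Ioo (0 : ℝ) 1) (L : Vec →L[ℂ] F →L[ℂ] Vec) :
    Lp F 2 (volume : Measure Pt) →L[ℂ] Lp Vec 2 (volume : Measure Pt) :=
  L.holderL volume ⊤ 2 2 (weight_msym_memLp κ s).toLp

theorem mulOp_ae (κ : ℝ) (s : Set.Ioo (0 : ℝ) 1) (L : Vec →L[ℂ] F →L[ℂ] Vec)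
    (G : Lp F 2 (volume : Measure Pt)) :
    ∀ᵐ ξ, mulOp κ s L G ξ = (jw (-s) ξ : ℂ) • L (msym κ s ξ) (G ξ) := by
  filter_upwards [L.coeFn_holder (r := 2) (weight_msym_memLp κ s).toLp G,
    (weight_msym_memLp κ s).coeFn_toLp] with ξ h1 h2
  refine h1.trans ?_
  rw [h2, map_smul, smul_apply]

/-- Weight bookkeeping: `jw (-t)` splits as `jw (-(t - s)) * jw (-s)`, and the second factor makes
the symbol bounded. This is the loss of `s` derivatives. -/
theorem mulOp_schwartz_ae (κ : ℝ) (s : Set.Ioo (0 : ℝ) 1) (L : Vec →L[ℂ] F →L[ℂ] Vec) {t : ℝ}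
    {w : 𝓢(Pt, F)} {W : Lp F 2 (volume : Measure Pt)} (hW : HasHat t (w : 𝓢'(Pt, F)) W) :
    ∀ᵐ ξ, L (msym κ s ξ) (𝓕 w ξ) = (jw (-(t - s)) ξ : ℂ) • mulOp κ s L W ξ := by
  filter_upwards [hW.schwartz_ae, mulOp_ae κ s L W] with ξ h1 h2
  rw [h1, h2, map_smul, smul_smul, ← Complex.ofReal_mul, ← jw_add]
  congr 3
  ring

end MulOp

/-- `(m, φ) ↦ -c φ m`. -/
noncomputable def gradL (c : ℝ) : Vec →L[ℂ] ℂ →L[ℂ] Vec :=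
  (-(c : ℂ)) • (ContinuousLinearMap.lsmul ℂ ℂ).flip

/-- `(m, w) ↦ c m × w`. -/
noncomputable def rotL (c : ℝ) : Vec →L[ℂ] Vec →L[ℂ] Vec := (c : ℂ) • crossL

theorem gradL_apply (c : ℝ) (m : Vec) (φ : ℂ) : gradL c m φ = (-(c * φ)) • m := by
  simp [gradL, smul_smul]

theorem rotL_apply (c : ℝ) (m w : Vec) : rotL c m w = (c : ℂ) • cross m w := rfl

theorem cstar_integrand (κ c s : ℝ) (w : Pt → Vec) (x y : Pt) :
    c • ((‖x - y‖ ^ ((3 : ℝ) / 2))⁻¹ • CstarFun κ s w x y) =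
      rotL c (kern κ s (y - x)) (w (x + (y - x)) - w x) := by
  rw [rotL_apply, ← inv_smul_alpha κ s x y, add_sub_cancel, ← crossL_apply]
  rw [RCLike.real_smul_eq_coe_smul (K := ℂ) ((‖x - y‖ ^ ((3 : ℝ) / 2))⁻¹) (alpha κ s x y), map_smul,
    smul_apply, RCLike.real_smul_eq_coe_smul (K := ℂ) c,
    RCLike.real_smul_eq_coe_smul (K := ℂ) ((‖x - y‖ ^ ((3 : ℝ) / 2))⁻¹)]
  rfl

theorem dstar_integrand (κ c s : ℝ) (u : Pt → ℂ) (x y : Pt) :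
    c • ((‖x - y‖ ^ ((3 : ℝ) / 2))⁻¹ • DstarFun κ s u x y) =
      gradL c (kern κ s (y - x)) (u (x + (y - x)) - u x) := by
  rw [gradL_apply, ← inv_smul_alpha κ s x y, add_sub_cancel, DstarFun]
  ext i
  simp only [PiLp.smul_apply, Complex.real_smul, smul_eq_mul]
  ring

theorem integrable_rotL (κ c : ℝ) (s : Set.Ioo (0 : ℝ) 1) (w : 𝓢(Pt, Vec)) (x : Pt) :
    Integrable fun y => c • ((‖x - y‖ ^ ((3 : ℝ) / 2))⁻¹ • CstarFun κ s w x y) := by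
  simp only [cstar_integrand]
  exact (nonlocal_integrable_and_eq (rotL c) (kern_kerInt κ s) w x).1.comp_sub_right x

theorem integrable_gradL (κ c : ℝ) (s : Set.Ioo (0 : ℝ) 1) (u : 𝓢(Pt, ℂ)) (x : Pt) :
    Integrable fun y => c • ((‖x - y‖ ^ ((3 : ℝ) / 2))⁻¹ • DstarFun κ s u x y) := by
  simp only [dstar_integrand]
  exact (nonlocal_integrable_and_eq (gradL c) (kern_kerInt κ s) u x).1.comp_sub_right x

theorem PiFun_cstar (κ c : ℝ) (s : Set.Ioo (0 : ℝ) 1) (w : 𝓢(Pt, Vec)) :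
    PiFun c (CstarFun κ s w) = 𝓕⁻ fun ξ => rotL c (msym κ s ξ) (𝓕 w ξ) := by
  funext x
  rw [PiFun, ← integral_smul]
  simp only [cstar_integrand]
  rw [integral_sub_right_eq_self (fun z => rotL c (kern κ s z) (w (x + z) - w x))]
  exact (nonlocal_integrable_and_eq (rotL c) (kern_kerInt κ s) w x).2

theorem PiFun_dstar (κ c : ℝ) (s : Set.Ioo (0 : ℝ) 1) (u : 𝓢(Pt, ℂ)) :
    PiFun c (DstarFun κ s u) = 𝓕⁻ fun ξ => gradL c (msym κ s ξ) (𝓕 u ξ) := by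
  funext x
  rw [PiFun, ← integral_smul]
  simp only [dstar_integrand]
  rw [integral_sub_right_eq_self (fun z => gradL c (kern κ s z) (u (x + z) - u x))]
  exact (nonlocal_integrable_and_eq (gradL c) (kern_kerInt κ s) u x).2

theorem PiFun_add (κ c : ℝ) (s : Set.Ioo (0 : ℝ) 1) (u : 𝓢(Pt, ℂ)) (w : 𝓢(Pt, Vec)) :
    PiFun c (fun x y => DstarFun κ s u x y + CstarFun κ s w x y) =
      𝓕⁻ fun ξ => gradL c (msym κ s ξ) (𝓕 u ξ) + rotL c (msym κ s ξ) (𝓕 w ξ) := by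
  have hU := integrable_symb_fourier (gradL c) (kern_kerInt κ s) u
  have hW := integrable_symb_fourier (rotL c) (kern_kerInt κ s) w
  have h1 : PiFun c (fun x y => DstarFun κ s u x y + CstarFun κ s w x y) =
      PiFun c (DstarFun κ s u) + PiFun c (CstarFun κ s w) := by
    funext x
    simp only [PiFun, Pi.add_apply, ← integral_smul]
    rw [← integral_add (integrable_gradL κ c s u x) (integrable_rotL κ c s w x)]
    simp only [smul_add]
  rw [h1, PiFun_dstar, PiFun_cstar]
  funext x
  simp only [Pi.add_apply, Real.fourierInv_eq_fourier_comp_neg]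
  exact (congrFun (VectorFourier.fourierIntegral_add Real.continuous_fourierChar
    (L := innerₗ Pt) continuous_inner hU.comp_neg hW.comp_neg) x).symm

theorem hasHat_of_represents_cstar {κ c : ℝ} {s : Set.Ioo (0 : ℝ) 1} {t : ℝ} {w : 𝓢(Pt, Vec)}
    {W : Lp Vec 2 (volume : Measure Pt)} (hW : HasHat t (w : 𝓢'(Pt, Vec)) W) {h : 𝓢'(Pt, Vec)}
    (hr : Represents h (PiFun c (CstarFun κ s w))) : HasHat (t - s) h (mulOp κ s (rotL c) W) := by
  rw [PiFun_cstar] at hr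
  exact hasHat_of_eq_integral
    (hr.fourier (integrable_symb_fourier (rotL c) (kern_kerInt κ s) w))
    (mulOp_schwartz_ae κ s (rotL c) hW)

theorem hasHat_of_represents_add {κ c : ℝ} {s : Set.Ioo (0 : ℝ) 1} {t : ℝ} {u : 𝓢(Pt, ℂ)}
    {w : 𝓢(Pt, Vec)} {U : Lp ℂ 2 (volume : Measure Pt)} {W : Lp Vec 2 (volume : Measure Pt)}
    (hU : HasHat t (u : 𝓢'(Pt, ℂ)) U) (hW : HasHat t (w : 𝓢'(Pt, Vec)) W) {h : 𝓢'(Pt, Vec)}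
    (hr : Represents h (PiFun c fun x y => DstarFun κ s u x y + CstarFun κ s w x y)) :
    HasHat (t - s) h (mulOp κ s (gradL c) U + mulOp κ s (rotL c) W) := by
  rw [PiFun_add] at hr
  refine hasHat_of_eq_integral (hr.fourier
    ((integrable_symb_fourier (gradL c) (kern_kerInt κ s) u).add
      (integrable_symb_fourier (rotL c) (kern_kerInt κ s) w))) ?_
  filter_upwards [mulOp_schwartz_ae κ s (gradL c) hU, mulOp_schwartz_ae κ s (rotL c) hW,
    Lp.coeFn_add (mulOp κ s (gradL c) U) (mulOp κ s (rotL c) W)] with ξ h1 h2 h3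
  exact (congrArg₂ (· + ·) h1 h2).trans (by rw [h3, Pi.add_apply, smul_add])

theorem exists_represents_fourierInv {U : Pt → Vec} (hU : Integrable U) :
    ∃ h : 𝓢'(Pt, Vec), Represents h (𝓕⁻ U) :=
  exists_represents (continuous_fourierInv_of_integrable hU) (norm_fourierInv_le U)

/-- On Schwartz fields the density of the image is forced to be `mulOp` of the density of the field.
Continuity of `mulOp` identifies every limit, and density of Schwartz functions supplies an
approximating sequence. -/
theorem hasPiCurl_iff {κ c : ℝ} {s : Set.Ioo (0 : ℝ) 1} {t : ℝ} {f g : 𝓢'(Pt, Vec)} :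
    HasPiCurl κ c s t f g ↔ ∃ G, HasHat t f G ∧ HasHat (t - s) g (mulOp κ s (rotL c) G) := by
  constructor
  · rintro ⟨w, h, hw, hr, hg⟩
    obtain ⟨W, G, hW, hG, hlim⟩ := hsTendsto_iff.1 hw
    obtain ⟨H, K, hH, hK, hlim'⟩ := hsTendsto_iff.1 hg
    have e : H = fun n => mulOp κ s (rotL c) (W n) :=
      funext fun n => (hH n).unique (hasHat_of_represents_cstar (hW n) (hr n))
    have := tendsto_nhds_unique (e ▸ hlim') (((mulOp κ s (rotL c)).continuous.tendsto G).comp hlim)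
    exact ⟨G, hG, this ▸ hK⟩
  · rintro ⟨G, hG, hg⟩
    obtain ⟨w, W, hW, hlim⟩ := exists_schwartz_tendsto t G
    have hex (n : ℕ) : ∃ h : 𝓢'(Pt, Vec), Represents h (PiFun c (CstarFun κ s (w n))) := by
      rw [PiFun_cstar]
      exact exists_represents_fourierInv (integrable_symb_fourier (rotL c) (kern_kerInt κ s) _)
    choose h hr using hex
    exact ⟨w, h, hsTendsto_iff.2 ⟨W, G, hW, hG, hlim⟩, hr,
      hsTendsto_iff.2 ⟨_, _, fun n => hasHat_of_represents_cstar (hW n) (hr n), hg,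
        ((mulOp κ s (rotL c)).continuous.tendsto G).comp hlim⟩⟩

theorem hasPi_iff {κ c : ℝ} {s : Set.Ioo (0 : ℝ) 1} {r : ℝ} {v : TwoPt} {u : 𝓢'(Pt, Vec)} :
    HasPi κ c s r v u ↔ ∃ φ A Φ G, IsPotentials (r + s) φ A ∧ v = Dstar κ s φ + Cstar κ s A ∧
      HasHat (r + s) φ Φ ∧ HasHat (r + s) A G ∧
        HasHat r u (mulOp κ s (gradL c) Φ + mulOp κ s (rotL c) G) := by
  have hcont : Continuous fun p : Lp ℂ 2 (volume : Measure Pt) × Lp Vec 2 (volume : Measure Pt) =>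
      mulOp κ s (gradL c) p.1 + mulOp κ s (rotL c) p.2 := by fun_prop
  have hrs : r + s - s = r := by ring
  constructor
  · rintro ⟨φ, A, hp, hv, u', w, h, hu, hw, hr, hg⟩
    obtain ⟨U, Φ, hU, hΦ, hl⟩ := hsTendsto_iff.1 hu
    obtain ⟨W, G, hW, hG, hl'⟩ := hsTendsto_iff.1 hw
    obtain ⟨H, K, hH, hK, hlim⟩ := hsTendsto_iff.1 hg
    have e : H = fun n => mulOp κ s (gradL c) (U n) + mulOp κ s (rotL c) (W n) :=
      funext fun n => (hH n).unique (hrs ▸ hasHat_of_represents_add (hU n) (hW n) (hr n))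
    have := tendsto_nhds_unique (e ▸ hlim) ((hcont.tendsto (Φ, G)).comp (hl.prodMk_nhds hl'))
    exact ⟨φ, A, Φ, G, hp, hv, hΦ, hG, this ▸ hK⟩
  · rintro ⟨φ, A, Φ, G, hp, hv, hΦ, hG, hg⟩
    obtain ⟨u', U, hU, hl⟩ := exists_schwartz_tendsto (r + s) Φ
    obtain ⟨w, W, hW, hl'⟩ := exists_schwartz_tendsto (r + s) G
    have hex (n : ℕ) : ∃ h : 𝓢'(Pt, Vec), Represents h
        (PiFun c fun x y => DstarFun κ s (u' n) x y + CstarFun κ s (w n) x y) := by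
      rw [PiFun_add]
      exact exists_represents_fourierInv
        ((integrable_symb_fourier (gradL c) (kern_kerInt κ s) _).add
          (integrable_symb_fourier (rotL c) (kern_kerInt κ s) _))
    choose h hr using hex
    exact ⟨φ, A, hp, hv, u', w, h, hsTendsto_iff.2 ⟨U, Φ, hU, hΦ, hl⟩,
      hsTendsto_iff.2 ⟨W, G, hW, hG, hl'⟩, hr,
      hsTendsto_iff.2 ⟨_, _, fun n => hrs ▸ hasHat_of_represents_add (hU n) (hW n) (hr n), hg,
        (hcont.tendsto (Φ, G)).comp (hl.prodMk_nhds hl')⟩⟩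

/-! ### The divergence pairing by Plancherel -/

section Differences
variable {F : Type} [NormedAddCommGroup F] [InnerProductSpace ℂ F] [CompleteSpace F]

/-- The difference `w(· + z) - w`. -/
noncomputable def schwartzDiff (z : Pt) (w : 𝓢(Pt, F)) : 𝓢(Pt, F) :=
  SchwartzMap.compSubConstCLM ℂ (-z) w - w

theorem schwartzDiff_apply (z : Pt) (w : 𝓢(Pt, F)) (x : Pt) :
    schwartzDiff z w x = w (x + z) - w x := by
  simp [schwartzDiff]

theorem fourier_schwartzDiff (z : Pt) (w : 𝓢(Pt, F)) (ξ : Pt) :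
    𝓕 (schwartzDiff z w) ξ = (ee z ξ - 1) • 𝓕 w ξ := by
  rw [schwartzDiff, sub_eq_add_neg, FourierTransform.fourier_add, ← neg_one_smul ℂ w, fourier_smul]
  have h := congrFun (VectorFourier.fourierIntegral_comp_add_right Real.fourierChar
    (volume : Measure Pt) (innerₗ Pt) (w : Pt → F) z) ξ
  have h2 : 𝓕 (SchwartzMap.compSubConstCLM ℂ (-z) w) ξ = ee z ξ • 𝓕 w ξ := by
    refine Eq.trans ?_ h
    rw [SchwartzMap.fourier_coe]
    have : (SchwartzMap.compSubConstCLM ℂ (-z) w : Pt → F) = (w : Pt → F) ∘ fun v => v + z := by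
      ext v; simp
    rw [this]
    rfl
  rw [sub_smul, one_smul, ← h2]
  simp [sub_eq_add_neg]

theorem fourierInv_schwartzDiff (z : Pt) (w : 𝓢(Pt, F)) (ξ : Pt) :
    𝓕⁻ (schwartzDiff z w) ξ = (ee z (-ξ) - 1) • 𝓕⁻ w ξ := by
  have h := fourier_schwartzDiff z w (-ξ)
  rw [SchwartzMap.fourier_coe, SchwartzMap.fourier_coe, ← Real.fourierInv_eq_fourier_neg,
    ← Real.fourierInv_eq_fourier_neg, ← SchwartzMap.fourierInv_coe, ← SchwartzMap.fourierInv_coe] at h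
  exact h

end Differences

theorem ee_neg_sub_mul (z ξ : Pt) :
    (ee z (-ξ) - 1) * (ee z ξ - 1) = ((‖ee z ξ - 1‖ ^ 2 : ℝ) : ℂ) := by
  have h : ee z (-ξ) = (starRingEnd ℂ) (ee z ξ) := by
    rw [ee, ee, inner_neg_right, AddChar.map_neg_eq_inv, Circle.coe_inv_eq_conj]
  rw [h, ← Complex.normSq_eq_norm_sq, Complex.normSq_eq_conj_mul_self]
  simp

/-- Moving the inverse transform across the product turns the two differences into the conjugate
factors `e^{-2πi z·ξ} - 1` and `e^{2πi z·ξ} - 1`. -/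
theorem integral_schwartzDiff_mul (z : Pt) (φ ψ : 𝓢(Pt, ℂ)) :
    ∫ x, ((𝓕 ψ : 𝓢(Pt, ℂ)) (x + z) - (𝓕 ψ : 𝓢(Pt, ℂ)) x) * (φ (x + z) - φ x) =
      ∫ ξ, ((‖ee z ξ - 1‖ ^ 2 : ℝ) : ℂ) * (ψ ξ * 𝓕 φ ξ) := by
  have h := SchwartzMap.integral_fourier_mul_eq (𝓕⁻ (schwartzDiff z (𝓕 ψ)))
    (𝓕⁻ (𝓕 (schwartzDiff z φ)))
  have h2 := SchwartzMap.integral_fourierInv_mul_eq (schwartzDiff z (𝓕 ψ)) (𝓕 (schwartzDiff z φ))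
  rw [fourierInv_fourier_eq] at h2
  simp only [schwartzDiff_apply] at h2
  rw [← h2]
  refine integral_congr_ae (Eventually.of_forall fun ξ => ?_)
  simp only [fourierInv_schwartzDiff, fourier_schwartzDiff, fourierInv_fourier_eq]
  rw [← ee_neg_sub_mul]
  simp only [smul_eq_mul]; ring

theorem integral_norm_sq_schwartzDiff_le (φ : 𝓢(Pt, ℂ)) :
    ∃ C, ∀ z, ∫ x, ‖φ (x + z) - φ x‖ ^ 2 ≤ C * (min 1 ‖z‖) ^ 2 := by
  have hi : Integrable fun ξ => ((1 + ‖ξ‖) * ‖𝓕 φ ξ‖) ^ 2 := by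
    obtain ⟨C, hC⟩ : ∃ C, ∀ ξ, ‖𝓕 φ ξ‖ ≤ C := ⟨_, (𝓕 φ).norm_le_seminorm ℂ⟩
    refine ((integrable_weight_fourier φ 2).const_mul C).mono' ?_ (Eventually.of_forall fun ξ => ?_)
    · exact (((continuous_const.add continuous_norm).mul (𝓕 φ).continuous.norm).pow 2).aestronglyMeasurable
    · rw [Real.norm_of_nonneg (by positivity), mul_pow]
      calc (1 + ‖ξ‖) ^ 2 * ‖𝓕 φ ξ‖ ^ 2 = ‖𝓕 φ ξ‖ * ((1 + ‖ξ‖) ^ 2 * ‖𝓕 φ ξ‖) := by ring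
        _ ≤ C * ((1 + ‖ξ‖) ^ 2 * ‖𝓕 φ ξ‖) :=
          mul_le_mul_of_nonneg_right (hC ξ) (by positivity)
  refine ⟨(2 * Real.pi) ^ 2 * ∫ ξ, ((1 + ‖ξ‖) * ‖𝓕 φ ξ‖) ^ 2, fun z => ?_⟩
  have e := SchwartzMap.integral_norm_sq_fourier (schwartzDiff z φ)
  simp only [schwartzDiff_apply] at e
  rw [← e, mul_right_comm, ← integral_const_mul]
  refine integral_mono_of_nonneg (Eventually.of_forall fun ξ => by positivity) (hi.const_mul _)
    (Eventually.of_forall fun ξ => ?_)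
  simp only [fourier_schwartzDiff, norm_smul]
  rw [← mul_pow, ← mul_pow]
  refine pow_le_pow_left₀ (by positivity) ?_ 2
  refine (mul_le_mul_of_nonneg_right (norm_ee_sub_one_le z ξ) (norm_nonneg _)).trans_eq ?_
  ring

/-- Integrating in `x` first gives, by Plancherel, at most a constant times `min(1,|z|)²`, exactly
the weight that makes `|z|^{-(3+2s)}` integrable. -/
theorem integrable_kern2_mul_sq (κ : ℝ) (s : Set.Ioo (0 : ℝ) 1) (φ : 𝓢(Pt, ℂ)) :
    Integrable (fun p : Pt × Pt => ‖kern2 κ s p.2‖ * ‖φ (p.1 + p.2) - φ p.1‖ ^ 2)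
      ((volume : Measure Pt).prod volume) := by
  have hm : AEStronglyMeasurable
      (fun p : Pt × Pt => ‖kern2 κ s p.2‖ * ‖φ (p.1 + p.2) - φ p.1‖ ^ 2)
      ((volume : Measure Pt).prod volume) := by
    refine (kern2_kerInt κ s).aesm.norm.comp_snd.mul (Continuous.aestronglyMeasurable ?_)
    have := φ.continuous
    fun_prop
  rw [integrable_prod_iff' hm]
  constructor
  · refine Eventually.of_forall fun z => ?_
    have h := ((schwartzDiff z φ).memLp 2 volume).integrable_norm_pow (by norm_num)
    simp only [schwartzDiff_apply] at h
    exact h.const_mul ‖kern2 κ s z‖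
  · obtain ⟨C, hC⟩ := integral_norm_sq_schwartzDiff_le φ
    refine ((kern2_kerInt κ s).norm.const_mul C).mono' ?_ (Eventually.of_forall fun z => ?_)
    · exact hm.norm.prod_swap.integral_prod_right'
    · simp only [norm_mul, norm_norm, norm_pow, norm_smul, integral_const_mul]
      rw [Real.norm_of_nonneg (by positivity), Real.norm_of_nonneg (by positivity)]
      refine (mul_le_mul_of_nonneg_left (hC z) (norm_nonneg _)).trans_eq ?_
      ring

theorem integrable_kern2_mul (κ : ℝ) (s : Set.Ioo (0 : ℝ) 1) (φ ψ : 𝓢(Pt, ℂ)) :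
    Integrable (fun p : Pt × Pt => kern2 κ s p.2 * ((ψ (p.1 + p.2) - ψ p.1) * (φ (p.1 + p.2) - φ p.1)))
      ((volume : Measure Pt).prod volume) := by
  refine ((integrable_kern2_mul_sq κ s ψ).add (integrable_kern2_mul_sq κ s φ)).mono' ?_
    (Eventually.of_forall fun p => ?_)
  · refine (kern2_kerInt κ s).aesm.comp_snd.mul (Continuous.aestronglyMeasurable ?_)
    have := φ.continuous
    have := ψ.continuous
    fun_prop
  · simp only [norm_mul, Pi.add_apply, ← mul_add]
    refine mul_le_mul_of_nonneg_left ?_ (norm_nonneg _)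
    nlinarith [sq_nonneg (‖ψ (p.1 + p.2) - ψ p.1‖ - ‖φ (p.1 + p.2) - φ p.1‖),
      sq_nonneg (‖ψ (p.1 + p.2) - ψ p.1‖), sq_nonneg ‖φ (p.1 + p.2) - φ p.1‖]

theorem integral_kern2_mul (κ : ℝ) (s : Set.Ioo (0 : ℝ) 1) (φ ψ : 𝓢(Pt, ℂ)) :
    ∫ p : Pt × Pt, kern2 κ s p.2 * (((𝓕 ψ : 𝓢(Pt, ℂ)) (p.1 + p.2) - (𝓕 ψ : 𝓢(Pt, ℂ)) p.1) *
      (φ (p.1 + p.2) - φ p.1)) = ∫ ξ, ψ ξ • (nsym κ s ξ * 𝓕 φ ξ) := by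
  have hj : Integrable (fun p : Pt × Pt => kern2 κ s p.1 *
      (((‖ee p.1 p.2 - 1‖ ^ 2 : ℝ) : ℂ) * (ψ p.2 * 𝓕 φ p.2))) ((volume : Measure Pt).prod volume) := by
    obtain ⟨C, hC⟩ : ∃ C, ∀ ξ, ‖ψ ξ‖ ≤ C := ⟨_, ψ.norm_le_seminorm ℂ⟩
    refine (((kern2_kerInt κ s).norm.mul_prod (integrable_weight_fourier φ 2)).const_mul
      ((2 * Real.pi) ^ 2 * C)).mono' ?_ (Eventually.of_forall fun p => ?_)
    · refine (kern2_kerInt κ s).aesm.comp_fst.mul (Continuous.aestronglyMeasurable ?_)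
      have h1 : Continuous fun p : Pt × Pt => ((‖ee p.1 p.2 - 1‖ ^ 2 : ℝ) : ℂ) :=
        Complex.continuous_ofReal.comp ((ee_continuous.sub continuous_const).norm.pow 2)
      exact h1.mul ((ψ.continuous.comp continuous_snd).mul ((𝓕 φ).continuous.comp continuous_snd))
    · have h1 := norm_ee_sub_one_le p.1 p.2
      have h2 := hC p.2
      have hC0 : 0 ≤ C := (norm_nonneg _).trans h2
      simp only [norm_mul, norm_smul, norm_pow, Complex.norm_real, norm_norm]
      rw [Real.norm_of_nonneg (by positivity : 0 ≤ min 1 ‖p.1‖)]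
      have h3 : ‖ee p.1 p.2 - 1‖ ^ 2 * (‖ψ p.2‖ * ‖𝓕 φ p.2‖) ≤
          (2 * Real.pi * (1 + ‖p.2‖) * min 1 ‖p.1‖) ^ 2 * (C * ‖𝓕 φ p.2‖) :=
        mul_le_mul (pow_le_pow_left₀ (norm_nonneg _) h1 2)
          (mul_le_mul_of_nonneg_right h2 (norm_nonneg _))
          (mul_nonneg (norm_nonneg _) (norm_nonneg _)) (by positivity)
      refine (mul_le_mul_of_nonneg_left h3 (norm_nonneg _)).trans_eq ?_
      ring
  rw [Measure.volume_eq_prod, integral_prod_symm _ (integrable_kern2_mul κ s φ (𝓕 ψ))]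
  simp only [integral_const_mul, integral_schwartzDiff_mul]
  simp only [← integral_const_mul]
  rw [integral_integral_swap hj]
  refine integral_congr_ae (Eventually.of_forall fun ξ => ?_)
  simp only [nsym, symb, smul_eq_mul, ← integral_mul_const, ← integral_const_mul]
  refine integral_congr_ae (Eventually.of_forall fun z => ?_)
  simp only; ring

theorem dot_cross_self (u v : Vec) : dot (cross u v) u = 0 := by
  simp [dot, cross, crossProduct, Fin.sum_univ_three]
  ring

/-- The curl part is orthogonal to `α(x,y)` and `𝒟*ψ` is a multiple of it, so `w` drops out. -/
theorem dot_dstar (κ s : ℝ) (φ ψ : Pt → ℂ) (w : Pt → Vec) (x y : Pt) :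
    dot (DstarFun κ s φ x y + CstarFun κ s w x y) (DstarFun κ s ψ x y) =
      kern2 κ s (y - x) * ((ψ y - ψ x) * (φ y - φ x)) := by
  have h : alpha κ s x y = alpha κ s 0 (y - x) := by simp [alpha]
  have hc := dot_cross_self (alpha κ s x y) (w y - w x)
  rw [kern2, ← h]
  simp only [dot, DstarFun, CstarFun, PiLp.add_apply, PiLp.smul_apply, smul_eq_mul] at hc ⊢
  simp only [Fin.sum_univ_three] at hc ⊢
  linear_combination (-(ψ y - ψ x)) * hc

theorem integral_dot_dstar (κ : ℝ) (s : Set.Ioo (0 : ℝ) 1) (φ ψ : 𝓢(Pt, ℂ)) (w : Pt → Vec) :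
    ∫ p : Pt × Pt, dot (DstarFun κ s φ p.1 p.2 + CstarFun κ s w p.1 p.2)
      (DstarFun κ s (𝓕 ψ : 𝓢(Pt, ℂ)) p.1 p.2) = ∫ ξ, ψ ξ • (nsym κ s ξ * 𝓕 φ ξ) := by
  rw [← integral_kern2_mul]
  simp only [dot_dstar]
  -- The shear `(x,z) ↦ (x, x + z)` preserves the product measure.
  have h := (measurePreserving_prod_add (volume : Measure Pt) (volume : Measure Pt)).integral_comp
    (MeasurableEquiv.shearAddRight Pt).measurableEmbedding
    (fun p : Pt × Pt => kern2 κ s (p.2 - p.1) *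
      (((𝓕 ψ : 𝓢(Pt, ℂ)) p.2 - (𝓕 ψ : 𝓢(Pt, ℂ)) p.1) * (φ p.2 - φ p.1)))
  simp only [add_sub_cancel_left] at h
  exact h.symm

theorem weight_nsym_memLp (κ : ℝ) (s : Set.Ioo (0 : ℝ) 1) :
    MemLp (fun ξ => (jw (-(2 * s)) ξ : ℂ) • nsym κ s ξ) ⊤ (volume : Measure Pt) := by
  obtain ⟨B, hB⟩ := nsym_bound κ s
  refine memLp_top_of_bound (C := B) ?_ (Eventually.of_forall fun ξ => ?_)
  · exact (Complex.continuous_ofReal.comp (jw_continuous _)).aestronglyMeasurable.smul (nsym_aesm κ s)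
  · rw [norm_smul, Complex.norm_real, Real.norm_of_nonneg (jw_pos _ _).le]
    calc jw (-(2 * s)) ξ * ‖nsym κ s ξ‖ ≤ jw (-(2 * s)) ξ * (B * jw (2 * s) ξ) :=
          mul_le_mul_of_nonneg_left (hB ξ) (jw_pos _ _).le
      _ = B * (jw (-(2 * s)) ξ * jw (2 * s) ξ) := by ring
      _ = B := by rw [jw_neg_mul, mul_one]

/-- Multiplication by the normalised symbol of `𝒟𝒟*` on `L²`. -/
noncomputable def nOp (κ : ℝ) (s : Set.Ioo (0 : ℝ) 1) :
    Lp ℂ 2 (volume : Measure Pt) →L[ℂ] Lp ℂ 2 (volume : Measure Pt) :=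
  (ContinuousLinearMap.lsmul ℂ ℂ).holderL volume ⊤ 2 2 (weight_nsym_memLp κ s).toLp

theorem nOp_ae (κ : ℝ) (s : Set.Ioo (0 : ℝ) 1) (G : Lp ℂ 2 (volume : Measure Pt)) :
    ∀ᵐ ξ, nOp κ s G ξ = (jw (-(2 * s)) ξ : ℂ) * (nsym κ s ξ * G ξ) := by
  filter_upwards [(ContinuousLinearMap.lsmul ℂ ℂ).coeFn_holder (r := 2)
    (weight_nsym_memLp κ s).toLp G, (weight_nsym_memLp κ s).coeFn_toLp] with ξ h1 h2
  refine h1.trans ?_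
  rw [h2]
  simp [mul_assoc]

theorem HasDiv.exists_hasHat {κ : ℝ} {s : Set.Ioo (0 : ℝ) 1} {r : ℝ} {v : TwoPt} {g : 𝓢'(Pt, ℂ)}
    (h : HasDiv κ s r v g) : ∃ φ A Φ, IsPotentials (r + s) φ A ∧ v = Dstar κ s φ + Cstar κ s A ∧
      HasHat (r + s) φ Φ ∧ HasHat (r - s) g (nOp κ s Φ) := by
  obtain ⟨φ, A, hp, hv, u, w, h, hu, hw, hr, hg⟩ := h
  obtain ⟨U, Φ, hU, hΦ, hl⟩ := hsTendsto_iff.1 hu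
  obtain ⟨H, K, hH, hK, hlim⟩ := hsTendsto_iff.1 hg
  have e : H = fun n => nOp κ s (U n) := by
    funext n
    refine (hH n).unique (hasHat_of_eq_integral (U := fun ξ => nsym κ s ξ * 𝓕 (u n) ξ)
      (fun ψ => ?_) ?_)
    · rw [hr, integral_dot_dstar]
    · filter_upwards [(hU n).schwartz_ae, nOp_ae κ s (U n)] with ξ h1 h2
      have h3 : jw (-(r + s)) ξ = jw (-(r - s)) ξ * jw (-(2 * s)) ξ := by
        rw [← jw_add]; congr 1; ring
      rw [h1, h2, h3]
      simp only [smul_eq_mul]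
      push_cast
      ring
  have := tendsto_nhds_unique (e ▸ hlim) (((nOp κ s).continuous.tendsto Φ).comp hl)
  exact ⟨φ, A, Φ, hp, hv, hΦ, this ▸ hK⟩

theorem hasDiv_cstar_zero {κ : ℝ} {s : Set.Ioo (0 : ℝ) 1} {r : ℝ} {A : 𝓢'(Pt, Vec)}
    (hp : IsPotentials (r + s) 0 A) : HasDiv κ s r (Cstar κ s A) 0 := by
  obtain ⟨G, hG⟩ := memSobolev_iff_hasHat.1 hp.memSobolev_vector
  obtain ⟨w, W, hW, hl⟩ := exists_schwartz_tendsto (r + s) G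
  have hz (t : ℝ) : HsTendsto t (fun _ => (0 : 𝓢'(Pt, ℂ))) 0 :=
    hsTendsto_iff.2 ⟨fun _ => 0, 0, fun _ => hasHat_zero t, hasHat_zero t, tendsto_const_nhds⟩
  refine ⟨0, A, hp, by simp, fun _ => 0, w, fun _ => 0, ?_, hsTendsto_iff.2 ⟨W, G, hW, hG, hl⟩,
    fun n ψ => ?_, hz _⟩
  · simpa using hz (r + s)
  · simp [dot_dstar]

/-! ### Off-diagonal test functions and the pairing with potentials -/

/-- `cplx` as a continuous linear map. -/
noncomputable def cplxL : Pt →L[ℝ] Vec :=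
  LinearMap.toContinuousLinearMap
    { toFun := cplx
      map_add' := fun a b => by ext i; simp [cplx]
      map_smul' := fun t a => by ext i; simp [cplx] }

theorem cplxL_apply (z : Pt) : cplxL z = cplx z := rfl

theorem integrable_smul_of_hasCompactSupport {F : Type} [NormedAddCommGroup F] [NormedSpace ℂ F]
    {w : Pt → ℂ} (hw : Continuous w)
    (hc : HasCompactSupport w) {q : Pt → F} (hq : Continuous q) : Integrable fun y => w y • q y :=
  (hw.smul hq).integrable_of_hasCompactSupport hc.smul_right

theorem hasCompactSupport_lineDerivOp {w : 𝓢(Pt, ℂ)} (hc : HasCompactSupport w) (m : Pt) :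
    HasCompactSupport (∂_{m} w : 𝓢(Pt, ℂ)) :=
  hc.of_isClosed_subset (isClosed_tsupport _) (SchwartzMap.tsupport_lineDerivOp_subset m w)

theorem integral_lineDerivOp_smul {F : Type} [NormedAddCommGroup F] [NormedSpace ℂ F]
    {w : 𝓢(Pt, ℂ)} (hc : HasCompactSupport w) (m : Pt)
    {q : Pt → F} (hq : ContDiff ℝ 1 q) :
    ∫ y, (∂_{m} w : 𝓢(Pt, ℂ)) y • q y = -∫ y, w y • fderiv ℝ q y m := by
  have hq' : Continuous fun y => fderiv ℝ q y m :=
    (hq.continuous_fderiv one_ne_zero).clm_apply continuous_const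
  have h := integral_smul_fderiv_eq_neg_fderiv_smul_of_integrable (μ := (volume : Measure Pt))
    (f := w) (g := q) (v := m)
    (by
      have := integrable_smul_of_hasCompactSupport (∂_{m} w : 𝓢(Pt, ℂ)).continuous
        (hasCompactSupport_lineDerivOp hc m) hq.continuous
      simpa only [SchwartzMap.lineDerivOp_apply_eq_fderiv] using this)
    (integrable_smul_of_hasCompactSupport w.continuous hc hq')
    (integrable_smul_of_hasCompactSupport w.continuous hc hq.continuous)
    (fun x _ => w.differentiableAt) (fun x _ => (hq.differentiable one_ne_zero) x)
  simp only [SchwartzMap.lineDerivOp_apply_eq_fderiv]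
  rw [h, neg_neg]

theorem integral_lineDerivOp_smul_cplx {w : 𝓢(Pt, ℂ)} (hc : HasCompactSupport w) (m x : Pt) :
    ∫ y, (∂_{m} w : 𝓢(Pt, ℂ)) y • cplx (y - x) = -((∫ y, w y) • cplx m) := by
  have hd (y : Pt) : HasFDerivAt (fun y => cplx (y - x)) cplxL y := by
    have := cplxL.hasFDerivAt.comp y ((hasFDerivAt_id y).sub_const x)
    simpa using! this
  have hq : ContDiff ℝ 1 fun y : Pt => cplx (y - x) :=
    cplxL.contDiff.comp (contDiff_id.sub contDiff_const)
  rw [integral_lineDerivOp_smul hc m hq]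
  simp only [fun y => (hd y).fderiv, cplxL_apply]
  rw [integral_smul_const]

theorem integral_lineDerivOp_zero {w : 𝓢(Pt, ℂ)} (hc : HasCompactSupport w) (m : Pt) :
    ∫ y, (∂_{m} w : 𝓢(Pt, ℂ)) y = 0 := by
  have h := integral_lineDerivOp_smul hc m (q := fun _ => (1 : ℂ)) contDiff_const
  simpa using h

/-- The factor with `gam(y - x) α(x,y) = y - x`. -/
noncomputable def gam (κ s : ℝ) (z : Pt) : ℝ := (√κ / √2)⁻¹ * ‖z‖ ^ ((3 : ℝ) / 2 + s + 1)

theorem gam_smul_alpha {κ : ℝ} (hκ : 0 < κ) (s : ℝ) (x y : Pt) :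
    (gam κ s (y - x) : ℂ) • alpha κ s x y = cplx (y - x) := by
  rcases eq_or_ne (y - x) 0 with h0 | h0
  · have hy : y = x := sub_eq_zero.1 h0
    ext i
    simp [hy, alpha, cplx]
  · have hp := norm_pos_iff.2 h0
    have h1 : ‖y - x‖ ^ ((3 : ℝ) / 2 + s + 1) ≠ 0 := by positivity
    have h2 : √κ / √2 ≠ 0 := by positivity
    ext i
    simp only [gam, alpha, cplx, PiLp.smul_apply, smul_eq_mul, PiLp.sub_apply]
    rw [← Complex.ofReal_mul]
    congr 1
    generalize ‖y - x‖ ^ ((3 : ℝ) / 2 + s + 1) = a at h1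
    generalize √κ / √2 = d at h2
    field_simp

theorem gam_neg (κ s : ℝ) (z : Pt) : gam κ s (-z) = gam κ s z := by simp [gam]

theorem gam_contDiffAt (κ s : ℝ) {z : Pt} (hz : z ≠ 0) : ContDiffAt ℝ ∞ (gam κ s) z := by
  unfold gam
  exact contDiffAt_const.mul ((contDiffAt_norm ℝ hz).rpow_const_of_ne (norm_ne_zero_iff.2 hz))

/-- The test function `f(x) g(y) gam(y - x) b`, for `f, g` with disjoint supports. -/
noncomputable def sepTest (κ s : ℝ) (b : Vec) (f g : 𝓢(Pt, ℂ)) (hf : HasCompactSupport f)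
    (hg : HasCompactSupport g) (hd : Disjoint (tsupport f) (tsupport g)) : TwoPtTest where
  toFun p := (f p.1 * g p.2 * gam κ s (p.2 - p.1)) • b
  contDiff' := by
    rw [contDiff_iff_contDiffAt]
    rintro ⟨x, y⟩
    have hf' : ContDiff ℝ ∞ fun p : Pt × Pt => f p.1 := (f.smooth ⊤).comp contDiff_fst
    have hg' : ContDiff ℝ ∞ fun p : Pt × Pt => g p.2 := (g.smooth ⊤).comp contDiff_snd
    -- On the diagonal, disjointness of the supports makes one of `f`, `g` vanish nearby; elsewhere
    -- `gam` is smooth.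
    rcases eq_or_ne y x with rfl | hxy
    · have hz : (fun p : Pt × Pt => (f p.1 * g p.2 * gam κ s (p.2 - p.1)) • b) =ᶠ[𝓝 (y, y)]
          fun _ => 0 := by
        by_cases hy : y ∈ tsupport f
        · have hy' : y ∉ tsupport g := fun h => Set.disjoint_left.1 hd hy h
          filter_upwards [continuous_snd.continuousAt.preimage_mem_nhds
            ((isClosed_tsupport g).isOpen_compl.mem_nhds hy')] with p hp
          rw [image_eq_zero_of_notMem_tsupport hp]; simp
        · filter_upwards [continuous_fst.continuousAt.preimage_mem_nhds
            ((isClosed_tsupport f).isOpen_compl.mem_nhds hy)] with p hp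
          rw [image_eq_zero_of_notMem_tsupport hp]; simp
      exact contDiffAt_const.congr_of_eventuallyEq hz
    · have h1 : ContDiffAt ℝ ∞ (fun p : Pt × Pt => gam κ s (p.2 - p.1)) (x, y) :=
        ContDiffAt.comp (g := gam κ s) (f := fun p : Pt × Pt => p.2 - p.1) (x, y)
          (gam_contDiffAt κ s (sub_ne_zero.2 hxy)) (contDiff_snd.sub contDiff_fst).contDiffAt
      have h2 : ContDiffAt ℝ ∞ (fun p : Pt × Pt => ((gam κ s (p.2 - p.1) : ℝ) : ℂ)) (x, y) :=
        Complex.ofRealCLM.contDiff.contDiffAt.comp (x, y) h1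
      exact ((hf'.contDiffAt.mul hg'.contDiffAt).mul h2).smul contDiffAt_const
  hasCompactSupport' := by
    refine HasCompactSupport.intro (hf.isCompact.prod hg.isCompact) fun p hp => ?_
    rw [Set.mem_prod, not_and_or] at hp
    rcases hp with hp | hp <;> rw [image_eq_zero_of_notMem_tsupport hp] <;> simp
  tsupport_subset' := by simp

theorem sepTest_apply (κ s : ℝ) (b : Vec) (f g : 𝓢(Pt, ℂ)) (hf : HasCompactSupport f)
    (hg : HasCompactSupport g) (hd : Disjoint (tsupport f) (tsupport g)) (p : Pt × Pt) :
    sepTest κ s b f g hf hg hd p = (f p.1 * g p.2 * gam κ s (p.2 - p.1)) • b := rfl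

/-- `gam` cancels the radial factor of `α`, leaving `y - x`; since `gam` is even, it does so for
both halves of the symmetrisation. Only moments of `f` and `g` of order at most one remain. -/
theorem testOp_sepTest {F : Type} [NormedAddCommGroup F] [NormedSpace ℂ F] [CompleteSpace F]
    (L : Vec →L[ℂ] Vec →L[ℂ] F) {κ : ℝ} (hκ : 0 < κ) (s : Set.Ioo (0 : ℝ) 1) (b : Vec)
    (f g : 𝓢(Pt, ℂ)) (hf : HasCompactSupport f)
    (hg : HasCompactSupport g) (hd : Disjoint (tsupport f) (tsupport g)) (x : Pt) :
    ∫ y, L (alpha κ s x y) (sepTest κ s b f g hf hg hd (x, y) + sepTest κ s b f g hf hg hd (y, x)) =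
      f x • L (∫ y, g y • cplx (y - x)) b + g x • L (∫ y, f y • cplx (y - x)) b := by
  have hc : Continuous fun y => cplx (y - x) := cplx_continuous.comp (continuous_sub_right x)
  have hfi := integrable_smul_of_hasCompactSupport f.continuous hf hc
  have hgi := integrable_smul_of_hasCompactSupport g.continuous hg hc
  have hF := (L.flip b).integral_comp_comm hfi
  have hG := (L.flip b).integral_comp_comm hgi
  have hF' := (L.flip b).integrable_comp hfi
  have hG' := (L.flip b).integrable_comp hgi
  simp only [ContinuousLinearMap.flip_apply] at hF hG hF' hG'
  have hG'' : Integrable fun y => f x • L (g y • cplx (y - x)) b := hG'.smul (f x)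
  have hF'' : Integrable fun y => g x • L (f y • cplx (y - x)) b := hF'.smul (g x)
  rw [← hF, ← hG, ← integral_smul, ← integral_smul, ← integral_add hG'' hF'']
  refine integral_congr_ae (Eventually.of_forall fun y => ?_)
  simp only [sepTest_apply]
  rw [← gam_smul_alpha hκ s x y, ← neg_sub y x, gam_neg, ← add_smul]
  simp only [map_smul, smul_apply, smul_smul, ← add_smul]
  congr 1
  ring

theorem exists_bump (p : Pt) {δ : ℝ} (hδ : 0 < δ) : ∃ G : 𝓢(Pt, ℂ), HasCompactSupport G ∧
    tsupport G ⊆ Metric.closedBall p δ ∧ (∫ y, G y) = 1 ∧ ∀ y, G y = ((‖G y‖ : ℝ) : ℂ) := by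
  let χ : ContDiffBump p := ⟨δ / 2, δ, by positivity, by linarith⟩
  have h₁ : HasCompactSupport fun z : Pt => ((χ.normed volume z : ℝ) : ℂ) :=
    χ.hasCompactSupport_normed.comp_left (g := fun x : ℝ => (x : ℂ)) (by simp)
  have h₂ : ContDiff ℝ ∞ fun z : Pt => ((χ.normed volume z : ℝ) : ℂ) :=
    Complex.ofRealCLM.contDiff.comp χ.contDiff_normed
  refine ⟨h₁.toSchwartzMap h₂, h₁, ?_, ?_, fun y => ?_⟩
  · refine (closure_mono ?_).trans (χ.tsupport_normed_eq (μ := volume)).subset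
    intro z hz
    simpa using hz
  · simp only [HasCompactSupport.toSchwartzMap_toFun]
    rw [integral_complex_ofReal, χ.integral_normed]
    simp
  · simp only [HasCompactSupport.toSchwartzMap_toFun, Complex.norm_real]
    rw [Real.norm_of_nonneg (χ.nonneg_normed y)]

theorem exists_bump_disjoint {h : 𝓢(Pt, ℂ)} (hc : HasCompactSupport h) : ∃ G : 𝓢(Pt, ℂ),
    HasCompactSupport G ∧ Disjoint (tsupport h) (tsupport G) ∧ ∫ y, G y = 1 := by
  obtain ⟨R, hR0, hR⟩ := hc.isCompact.isBounded.exists_pos_norm_le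
  -- A unit ball centred at distance `R + 2` stays outside the ball of radius `R` containing the
  -- support of `h`.
  obtain ⟨G, hG, hs, hi, -⟩ := exists_bump (EuclideanSpace.single 0 (R + 2)) one_pos
  refine ⟨G, hG, Set.disjoint_left.2 fun x hx hx' => ?_, hi⟩
  have h1 := hR x hx
  have h2 := hs hx'
  rw [mem_closedBall_iff_norm'] at h2
  have h3 := norm_sub_norm_le (EuclideanSpace.single 0 (R + 2) : Pt) x
  rw [PiLp.norm_single, Real.norm_of_nonneg (by positivity)] at h3
  linarith

/-- Take `g = ∂ₑG` with `∫ G = 1`, so that `∫ g(y)(y - x) dy = -e` for every `x`. With `f` a second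
derivative, its moments of order zero and one vanish, which kills the other half of the
symmetrisation. -/
theorem pairing_eq_zero {κ : ℝ} (hκ : 0 < κ) (s : Set.Ioo (0 : ℝ) 1) {φ : 𝓢'(Pt, ℂ)}
    {A : 𝓢'(Pt, Vec)} (h0 : Dstar κ s φ + Cstar κ s A = 0) {h : 𝓢(Pt, ℂ)}
    (hc : HasCompactSupport h) (m e : Pt) (b : Vec) :
    dot (cplx e) b * φ (∂_{m} (∂_{m} h)) + ∑ i, cross (cplx e) b i * A (∂_{m} (∂_{m} h)) i = 0 := by
  obtain ⟨G, hG, hd, hi⟩ := exists_bump_disjoint hc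
  have hc1 := hasCompactSupport_lineDerivOp hc m
  have hc2 := hasCompactSupport_lineDerivOp hc1 m
  have hGe := hasCompactSupport_lineDerivOp hG e
  have hd' : Disjoint (tsupport (∂_{m} (∂_{m} h) : 𝓢(Pt, ℂ))) (tsupport (∂_{e} G : 𝓢(Pt, ℂ))) :=
    hd.mono ((SchwartzMap.tsupport_lineDerivOp_subset m _).trans
      (SchwartzMap.tsupport_lineDerivOp_subset m h)) (SchwartzMap.tsupport_lineDerivOp_subset e G)
  set f : 𝓢(Pt, ℂ) := ∂_{m} (∂_{m} h) with hf
  set g : 𝓢(Pt, ℂ) := ∂_{e} G with hg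
  set Ψ := sepTest κ s b f g hc2 hGe hd' with hΨ
  have hop {F : Type} [NormedAddCommGroup F] [NormedSpace ℂ F] [CompleteSpace F]
      (L : Vec →L[ℂ] Vec →L[ℂ] F) (x : Pt) :
      ∫ y, L (alpha κ s x y) (Ψ (x, y) + Ψ (y, x)) = -(f x • L (cplx e) b) := by
    rw [hΨ, testOp_sepTest L hκ, hf, hg, integral_lineDerivOp_smul_cplx hG,
      integral_lineDerivOp_smul_cplx hc1, integral_lineDerivOp_zero hc, hi]
    simp
  have hD : divTest κ s Ψ = -(dot (cplx e) b • f) := by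
    ext x
    refine (hop dotL x).trans ?_
    simp [mul_comm]
  have hC (i : Fin 3) : (curlTest κ s Ψ).postcompCLM (EuclideanSpace.proj i : Vec →L[ℂ] ℂ) =
      -(cross (cplx e) b i • f) := by
    ext x
    refine (congrArg (fun v : Vec => v i) (hop crossL x)).trans ?_
    simp [mul_comm]
  have h1 := DFunLike.congr_fun h0 Ψ
  have h2 : φ (divTest κ s Ψ) +
      ∑ i, A ((curlTest κ s Ψ).postcompCLM (EuclideanSpace.proj i)) i = 0 := h1
  simp only [hD, hC, map_neg, map_smul] at h2
  simp only [PiLp.neg_apply, PiLp.smul_apply, smul_eq_mul, Finset.sum_neg_distrib] at h2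
  linear_combination -h2

theorem apply_lineDerivOp_eq_zero {κ : ℝ} (hκ : 0 < κ) (s : Set.Ioo (0 : ℝ) 1) {φ : 𝓢'(Pt, ℂ)}
    {A : 𝓢'(Pt, Vec)} (h0 : Dstar κ s φ + Cstar κ s A = 0) {h : 𝓢(Pt, ℂ)}
    (hc : HasCompactSupport h) (m : Pt) :
    φ (∂_{m} (∂_{m} h)) = 0 ∧ A (∂_{m} (∂_{m} h)) = 0 := by
  have key := pairing_eq_zero hκ s h0 hc m
  refine ⟨?_, ?_⟩
  · have := key (EuclideanSpace.single 0 1) (cplx (EuclideanSpace.single 0 1))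
    simpa [dot, cross, cplx, crossProduct, Fin.sum_univ_three] using this
  · ext i
    -- Indices are cyclic modulo 3: these two basis vectors are orthogonal and their cross product
    -- is the `i`-th one.
    have := key (EuclideanSpace.single (i + 1) 1) (cplx (EuclideanSpace.single (i + 2) 1))
    fin_cases i <;>
    simpa [dot, cross, cplx, crossProduct, Fin.sum_univ_three] using this

/-! ### Uniqueness of potentials -/

section Vanishing
variable {F : Type} [NormedAddCommGroup F] [InnerProductSpace ℂ F] [CompleteSpace F]

theorem ae_zero_of_translates {V : Pt → F} (hV : Integrable V)
    (h : ∀ a, ∫ ξ, ee a ξ • V ξ = 0) : V =ᵐ[volume] 0 := by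
  refine ae_eq_zero_of_schwartz hV.locallyIntegrable fun ψ => ?_
  rw [← integral_fourier_smul_fourierInv ψ hV]
  have : 𝓕⁻ V = 0 := by
    funext a
    rw [Real.fourierInv_eq, Pi.zero_apply, ← h a]
    refine integral_congr_ae (Eventually.of_forall fun ξ => ?_)
    simp only [ee, Circle.smul_def, real_inner_comm]
  simp [this]

theorem fourierInv_lineDerivOp_twice (h : 𝓢(Pt, ℂ)) (m ξ : Pt) :
    𝓕⁻ (∂_{m} (∂_{m} h)) ξ = ((2 * Real.pi * Complex.I) * (inner ℝ ξ m : ℝ)) ^ 2 * 𝓕⁻ h ξ := by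
  have ht : (fun x : Pt => inner ℝ x m).HasTemperateGrowth := by fun_prop
  rw [SchwartzMap.fourierInv_lineDerivOp_eq, SchwartzMap.fourierInv_lineDerivOp_eq]
  simp only [smul_apply, SchwartzMap.smulLeftCLM_apply_apply ht, smul_eq_mul,
    Complex.real_smul]
  ring

theorem fourierInv_compSubConst (h : 𝓢(Pt, ℂ)) (a ξ : Pt) :
    𝓕⁻ (SchwartzMap.compSubConstCLM ℂ a h) ξ = ee a ξ * 𝓕⁻ h ξ := by
  have e : SchwartzMap.compSubConstCLM ℂ a h = schwartzDiff (-a) h + h := by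
    simp [schwartzDiff]
  rw [e, FourierTransform.fourierInv_add]
  simp only [add_apply, fourierInv_schwartzDiff]
  have : ee (-a) (-ξ) = ee a ξ := by simp [ee]
  rw [this, smul_eq_mul]
  ring

theorem exists_fourierInv_ne_zero (k : ℕ) : ∃ h : 𝓢(Pt, ℂ), HasCompactSupport h ∧
    ∀ ξ : Pt, ‖ξ‖ ≤ k → 𝓕⁻ h ξ ≠ 0 := by
  -- On a support this small, `|e^{2πi x·ξ} - 1| ≤ 7/8` for `‖ξ‖ ≤ k` (using `π ≤ 7/2`), so the
  -- transform of a unit mass cannot reach zero.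
  have hδ : 0 < (1 : ℝ) / (8 * (k + 1)) := by positivity
  obtain ⟨h, hc, hs, hi, hn⟩ := exists_bump 0 hδ
  refine ⟨h, hc, fun ξ hξ h0 => ?_⟩
  have hei : Integrable fun x => ee x ξ * h x := by
    refine h.integrable.bdd_mul (c := 1) ?_ (Eventually.of_forall fun x => (norm_ee x ξ).le)
    exact (ee_continuous.comp (Continuous.prodMk_left ξ)).aestronglyMeasurable
  have e0 : ∫ x, ee x ξ * h x = 0 := by
    rw [← h0, SchwartzMap.fourierInv_coe, Real.fourierInv_eq]
    rfl
  have e1 : ∫ x, (1 - ee x ξ) * h x = 1 := by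
    simp only [sub_mul, one_mul]
    rw [integral_sub h.integrable hei, e0, hi, sub_zero]
  have hnorm : ∫ x, ‖h x‖ = 1 := by
    have : ((∫ x, ‖h x‖ : ℝ) : ℂ) = 1 := by
      rw [← integral_complex_ofReal, ← hi]
      exact integral_congr_ae (Eventually.of_forall fun x => (hn x).symm)
    exact_mod_cast this
  have hle : ‖∫ x, (1 - ee x ξ) * h x‖ ≤ ∫ x, (7 / 8 : ℝ) * ‖h x‖ := by
    refine norm_integral_le_of_norm_le (h.integrable.norm.const_mul _)
      (Eventually.of_forall fun x => ?_)
    rw [norm_mul]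
    by_cases hx : x ∈ tsupport h
    · refine mul_le_mul_of_nonneg_right ?_ (norm_nonneg _)
      have hx1 : ‖x‖ ≤ 1 / (8 * (k + 1)) := by simpa using hs hx
      rw [norm_sub_rev]
      refine (norm_ee_sub_one_le x ξ).trans ?_
      have hpi : Real.pi ≤ 7 / 2 := by linarith [Real.pi_lt_d2]
      calc 2 * Real.pi * (1 + ‖ξ‖) * min 1 ‖x‖ ≤ 2 * (7 / 2) * (1 + k) * (1 / (8 * (k + 1))) := by
            have := (min_le_right 1 ‖x‖).trans hx1
            gcongr
        _ = 7 / 8 := by field_simp; ring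
    · rw [image_eq_zero_of_notMem_tsupport hx]; simp
  rw [e1, integral_const_mul, hnorm] at hle
  norm_num at hle

/-- The hypothesis also covers all translates of `h`, so the inverse transform of an integrable
function vanishes and `(ξ·m)² (𝓕⁻ h)(ξ) G(ξ) = 0` almost everywhere. Countably many `h` with `𝓕⁻ h ≠
0` on growing balls, and the coordinate directions `m`, cover every `ξ ≠ 0`. -/
theorem eq_zero_of_lineDerivOp_eq_zero {t : ℝ} {u : 𝓢'(Pt, F)} {G : Lp F 2 (volume : Measure Pt)}
    (hG : HasHat t u G)
    (h0 : ∀ h : 𝓢(Pt, ℂ), HasCompactSupport h → ∀ m : Pt, u (∂_{m} (∂_{m} h)) = 0) : u = 0 := by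
  have key (h : 𝓢(Pt, ℂ)) (hc : HasCompactSupport h) (m : Pt) :
      ∀ᵐ ξ, 𝓕⁻ (∂_{m} (∂_{m} h)) ξ • ((jw (-t) ξ : ℂ) • G ξ) = 0 := by
    refine ae_zero_of_translates (integrable_schwartz_smul (-t) _ G) fun a => ?_
    have hca : HasCompactSupport (SchwartzMap.compSubConstCLM ℂ a h) := by
      have := hc.comp_homeomorph (Homeomorph.subRight a)
      exact this
    have h1 := hG (𝓕⁻ (∂_{m} (∂_{m} (SchwartzMap.compSubConstCLM ℂ a h))))
    rw [fourier_fourierInv_eq, h0 _ hca m] at h1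
    rw [h1]
    refine integral_congr_ae (Eventually.of_forall fun ξ => ?_)
    simp only [fourierInv_lineDerivOp_twice, fourierInv_compSubConst, smul_smul]
    congr 1
    ring
  choose h hc hne using exists_fourierInv_ne_zero
  have hall : ∀ᵐ ξ, ∀ k : ℕ, ∀ i : Fin 3,
      𝓕⁻ (∂_{EuclideanSpace.single i (1 : ℝ)} (∂_{EuclideanSpace.single i (1 : ℝ)} (h k))) ξ •
        ((jw (-t) ξ : ℂ) • G ξ) = 0 :=
    ae_all_iff.2 fun k => ae_all_iff.2 fun i => key (h k) (hc k) _
  have hz : ∀ᵐ ξ : Pt, ξ ≠ 0 := by simp [ae_iff]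
  have hG0 : G = 0 := by
    rw [Lp.eq_zero_iff_ae_eq_zero]
    filter_upwards [hall, hz] with ξ h1 h2
    obtain ⟨k, hk⟩ := exists_nat_ge ‖ξ‖
    obtain ⟨i, hi⟩ : ∃ i, ξ i ≠ 0 := by
      by_contra hcon
      push Not at hcon
      exact h2 (by ext i; simpa using hcon i)
    have h3 := h1 k i
    rw [fourierInv_lineDerivOp_twice, smul_smul, smul_eq_zero] at h3
    refine h3.resolve_left ?_
    have := hne k ξ hk
    simp [EuclideanSpace.inner_single_right, hi, this, (jw_pos (-t) ξ).ne', Real.pi_ne_zero]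
  exact hG.ext (hG0 ▸ hasHat_zero t)

end Vanishing

theorem potentials_eq_zero {κ : ℝ} (hκ : 0 < κ) (s : Set.Ioo (0 : ℝ) 1) {t : ℝ} {φ : 𝓢'(Pt, ℂ)}
    {A : 𝓢'(Pt, Vec)} (hp : IsPotentials t φ A) (h0 : Dstar κ s φ + Cstar κ s A = 0) :
    φ = 0 ∧ A = 0 := by
  obtain ⟨Φ, hΦ⟩ := memSobolev_iff_hasHat.1 hp.memSobolev_scalar
  obtain ⟨G, hG⟩ := memSobolev_iff_hasHat.1 hp.memSobolev_vector
  exact ⟨eq_zero_of_lineDerivOp_eq_zero hΦ fun h hc m => (apply_lineDerivOp_eq_zero hκ s h0 hc m).1,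
    eq_zero_of_lineDerivOp_eq_zero hG fun h hc m => (apply_lineDerivOp_eq_zero hκ s h0 hc m).2⟩

theorem potentials_unique {κ : ℝ} (hκ : 0 < κ) (s : Set.Ioo (0 : ℝ) 1) {t : ℝ} {φ φ' : 𝓢'(Pt, ℂ)}
    {A A' : 𝓢'(Pt, Vec)} (hp : IsPotentials t φ A) (hp' : IsPotentials t φ' A')
    (h : Dstar κ s φ + Cstar κ s A = Dstar κ s φ' + Cstar κ s A') : φ = φ' ∧ A = A' := by
  have e1 : φ + (-1 : ℂ) • φ' = φ - φ' := by
    rw [sub_eq_add_neg]; exact congrArg _ (neg_one_smul ℂ φ')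
  have e2 : A + (-1 : ℂ) • A' = A - A' := by
    rw [sub_eq_add_neg]; exact congrArg _ (neg_one_smul ℂ A')
  have hd := hp.add (hp'.smul (-1))
  rw [e1, e2] at hd
  obtain ⟨h1, h2⟩ := potentials_eq_zero hκ s hd (by
    rw [map_sub, map_sub, sub_add_sub_comm, h, sub_self])
  exact ⟨sub_eq_zero.1 h1, sub_eq_zero.1 h2⟩

/-! ### Vector algebra at a fixed frequency -/

theorem sum_sq_ne_zero {ξ : Pt} (h : ξ ≠ 0) : (ξ 0 : ℂ) ^ 2 + (ξ 1 : ℂ) ^ 2 + (ξ 2 : ℂ) ^ 2 ≠ 0 := by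
  have h1 : ‖ξ‖ ^ 2 ≠ 0 := pow_ne_zero 2 (norm_ne_zero_iff.2 h)
  rw [EuclideanSpace.norm_sq_eq, Fin.sum_univ_three] at h1
  simp only [Real.norm_eq_abs, sq_abs] at h1
  exact_mod_cast h1

theorem sum_mul_smul_cross (ξ : Pt) (a μ : ℂ) (w : Vec) :
    ∑ i, (ξ i : ℂ) * (a • cross (μ • cplx ξ) w) i = 0 := by
  simp [Fin.sum_univ_three, cross, cplx, cross_apply]
  ring

/-- The scalar product with `ξ` isolates `p`. Then `ξ × (ξ × v) = ξ (ξ·v) - |ξ|² v` recovers `v = w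
- w'`, which is orthogonal to `ξ`. The vectors are complex but `ξ` is real, so its bilinear square
is nonzero. -/
theorem eq_of_smul_add_cross_eq {ξ : Pt} (h : ξ ≠ 0) {p : ℂ} {w w' : Vec}
    (hw : ∑ i, (ξ i : ℂ) * w i = 0) (hw' : ∑ i, (ξ i : ℂ) * w' i = 0)
    (he : p • cplx ξ + cross (cplx ξ) w = cross (cplx ξ) w') : p = 0 ∧ w = w' := by
  have e0 := congrArg (fun v : Vec => v 0) he
  have e1 := congrArg (fun v : Vec => v 1) he
  have e2 := congrArg (fun v : Vec => v 2) he
  simp [cross, cplx, cross_apply] at e0 e1 e2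
  rw [Fin.sum_univ_three] at hw hw'
  have hs := sum_sq_ne_zero h
  have hp : p = 0 := by
    refine (mul_eq_zero.1 (?_ : ((ξ 0 : ℂ) ^ 2 + (ξ 1 : ℂ) ^ 2 + (ξ 2 : ℂ) ^ 2) * p = 0)).resolve_left hs
    linear_combination (ξ 0 : ℂ) * e0 + (ξ 1 : ℂ) * e1 + (ξ 2 : ℂ) * e2
  subst hp
  refine ⟨rfl, ?_⟩
  ext i
  refine mul_left_cancel₀ hs ?_
  fin_cases i
  · simp only [Fin.zero_eta]
    linear_combination (ξ 0 : ℂ) * (hw - hw') - (ξ 1 : ℂ) * e2 + (ξ 2 : ℂ) * e1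
  · simp only [Fin.mk_one]
    linear_combination (ξ 1 : ℂ) * (hw - hw') - (ξ 2 : ℂ) * e0 + (ξ 0 : ℂ) * e2
  · simp only [Fin.reduceFinMk]
    linear_combination (ξ 2 : ℂ) * (hw - hw') - (ξ 0 : ℂ) * e1 + (ξ 1 : ℂ) * e0

theorem ae_pt_ne_zero : ∀ᵐ ξ : Pt, ξ ≠ 0 := by simp [ae_iff]

theorem mulOp_rotL_divFree {κ : ℝ} (hκ : 0 < κ) (c : ℝ) (s : Set.Ioo (0 : ℝ) 1)
    (G : Lp Vec 2 (volume : Measure Pt)) :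
    ∀ᵐ ξ, ∑ i, (ξ i : ℂ) * mulOp κ s (rotL c) G ξ i = 0 := by
  filter_upwards [mulOp_ae κ s (rotL c) G, ae_pt_ne_zero] with ξ h1 h0
  obtain ⟨μ, -, hμ⟩ := exists_msym_eq hκ s h0
  rw [h1, rotL_apply, smul_smul, hμ]
  exact sum_mul_smul_cross ξ _ _ _

theorem mulOp_rotL_gradL {κ : ℝ} (c : ℝ) (s : Set.Ioo (0 : ℝ) 1)
    (Φ : Lp ℂ 2 (volume : Measure Pt)) :
    mulOp κ s (rotL c) (mulOp κ s (gradL c) Φ) = 0 := by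
  rw [Lp.eq_zero_iff_ae_eq_zero]
  filter_upwards [mulOp_ae κ s (rotL c) (mulOp κ s (gradL c) Φ), mulOp_ae κ s (gradL c) Φ]
    with ξ h1 h2
  rw [h1, h2, gradL_apply, map_smul, map_smul, rotL_apply]
  simp [cross]

theorem eq_of_mulOp_eq {κ c : ℝ} (hκ : 0 < κ) (hc : c ≠ 0) (s : Set.Ioo (0 : ℝ) 1)
    {Φ : Lp ℂ 2 (volume : Measure Pt)} {G G' : Lp Vec 2 (volume : Measure Pt)}
    (hG : ∀ᵐ ξ, ∑ i, (ξ i : ℂ) * G ξ i = 0) (hG' : ∀ᵐ ξ, ∑ i, (ξ i : ℂ) * G' ξ i = 0)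
    (h : mulOp κ s (gradL c) Φ + mulOp κ s (rotL c) G = mulOp κ s (rotL c) G') :
    Φ = 0 ∧ G = G' := by
  have key : ∀ᵐ ξ, Φ ξ = 0 ∧ G ξ = G' ξ := by
    filter_upwards [mulOp_ae κ s (rotL c) G, mulOp_ae κ s (gradL c) Φ, mulOp_ae κ s (rotL c) G',
      ae_pt_ne_zero, hG, hG', Lp.coeFn_add (mulOp κ s (gradL c) Φ) (mulOp κ s (rotL c) G)]
      with ξ h1 h2 h3 h0 hd hd' ha
    obtain ⟨μ, hμ0, hμ⟩ := exists_msym_eq hκ s h0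
    rw [h, Pi.add_apply, h1, h2, h3, ← smul_add] at ha
    have hj : (jw (-s) ξ : ℂ) ≠ 0 := by exact_mod_cast (jw_pos _ ξ).ne'
    have hcμ : (c : ℂ) * μ ≠ 0 := mul_ne_zero (by exact_mod_cast hc) hμ0
    have ha := smul_right_injective Vec hj ha
    rw [gradL_apply, rotL_apply, rotL_apply, hμ, ← crossL_apply, ← crossL_apply, map_smul,
      smul_apply, smul_apply, crossL_apply, crossL_apply, smul_smul, smul_smul, smul_smul] at ha
    have e := eq_of_smul_add_cross_eq h0 hd hd' (p := -Φ ξ)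
      (smul_right_injective Vec hcμ (by
        simp only
        rw [ha, smul_add, smul_smul]
        congr 2
        ring))
    exact ⟨neg_eq_zero.1 e.1, e.2⟩
  exact ⟨(Lp.eq_zero_iff_ae_eq_zero).2 (key.mono fun _ h => h.1), Lp.ext (key.mono fun _ h => h.2)⟩

/-! ### The two-point curl -/

/-- `w = 𝒞* (Π𝒞*) A` for a field `v = 𝒟*φ + 𝒞*A` of order `r`. -/
def IsCurlOfPotential (κ c : ℝ) (s : Set.Ioo (0 : ℝ) 1) (r : ℝ) (v w : TwoPt) : Prop :=
  ∃ φ A B, IsPotentials (r + s) φ A ∧ v = Dstar κ s φ + Cstar κ s A ∧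
    HasPiCurl κ c s (r + s) A B ∧ w = Cstar κ s B

theorem HasPiCurl.eq {κ c : ℝ} {s : Set.Ioo (0 : ℝ) 1} {t : ℝ} {f g g' : 𝓢'(Pt, Vec)}
    (h : HasPiCurl κ c s t f g) (h' : HasPiCurl κ c s t f g') : g = g' := by
  obtain ⟨G, hG, hg⟩ := hasPiCurl_iff.1 h
  obtain ⟨G', hG', hg'⟩ := hasPiCurl_iff.1 h'
  exact hg.ext (hG.unique hG' ▸ hg')

theorem HasPiCurl.add {κ c : ℝ} {s : Set.Ioo (0 : ℝ) 1} {t : ℝ} {f g f' g' : 𝓢'(Pt, Vec)}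
    (h : HasPiCurl κ c s t f g) (h' : HasPiCurl κ c s t f' g') :
    HasPiCurl κ c s t (f + f') (g + g') := by
  obtain ⟨G, hG, hg⟩ := hasPiCurl_iff.1 h
  obtain ⟨G', hG', hg'⟩ := hasPiCurl_iff.1 h'
  exact hasPiCurl_iff.2 ⟨G + G', hG.add hG', by rw [map_add]; exact hg.add hg'⟩

theorem HasPiCurl.smul {κ c : ℝ} {s : Set.Ioo (0 : ℝ) 1} {t : ℝ} {f g : 𝓢'(Pt, Vec)}
    (h : HasPiCurl κ c s t f g) (a : ℂ) : HasPiCurl κ c s t (a • f) (a • g) := by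
  obtain ⟨G, hG, hg⟩ := hasPiCurl_iff.1 h
  exact hasPiCurl_iff.2 ⟨a • G, hG.smul a, by rw [map_smul]; exact hg.smul a⟩

theorem exists_hasPiCurl (κ c : ℝ) (s : Set.Ioo (0 : ℝ) 1) {t : ℝ} {f : 𝓢'(Pt, Vec)}
    (h : MemSobolev t 2 f) : ∃ g, HasPiCurl κ c s t f g := by
  obtain ⟨G, hG⟩ := memSobolev_iff_hasHat.1 h
  obtain ⟨g, hg⟩ := exists_hasHat (t - s) (mulOp κ s (rotL c) G)
  exact ⟨g, hasPiCurl_iff.2 ⟨G, hG, hg⟩⟩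

theorem HasPiCurl.isPotentials {κ c : ℝ} (hκ : 0 < κ) {s : Set.Ioo (0 : ℝ) 1} {t : ℝ}
    {f g : 𝓢'(Pt, Vec)} (h : HasPiCurl κ c s t f g) : IsPotentials (t - s) 0 g := by
  obtain ⟨G, hG, hg⟩ := hasPiCurl_iff.1 h
  exact ⟨memSobolev_iff_hasHat.2 ⟨0, hasHat_zero _⟩, memSobolev_iff_hasHat.2 ⟨_, hg⟩,
    (isDivFree_iff hg).2 (mulOp_rotL_divFree hκ c s G)⟩

theorem IsCurlOfPotential.exists_isPotentials {κ c : ℝ} (hκ : 0 < κ) {s : Set.Ioo (0 : ℝ) 1}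
    {r : ℝ} {v w : TwoPt} (h : IsCurlOfPotential κ c s r v w) :
    ∃ B, IsPotentials (r - s + s) 0 B ∧ w = Cstar κ s B := by
  obtain ⟨φ, A, B, -, -, hB, hw⟩ := h
  refine ⟨B, ?_, hw⟩
  have := hB.isPotentials hκ
  rwa [show r + s - (s : ℝ) = r - s + s by ring] at this

theorem IsCurlOfPotential.mem {κ c : ℝ} (hκ : 0 < κ) {s : Set.Ioo (0 : ℝ) 1} {r : ℝ} {v w : TwoPt}
    (h : IsCurlOfPotential κ c s r v w) : w ∈ Hfhd κ s (r - s) := by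
  obtain ⟨B, hB, hw⟩ := h.exists_isPotentials hκ
  exact ⟨0, B, hB, by rw [hw, map_zero, zero_add]⟩

theorem IsCurlOfPotential.eq {κ c : ℝ} (hκ : 0 < κ) {s : Set.Ioo (0 : ℝ) 1} {r : ℝ}
    {v w w' : TwoPt} (h : IsCurlOfPotential κ c s r v w) (h' : IsCurlOfPotential κ c s r v w') :
    w = w' := by
  obtain ⟨φ, A, B, hp, hv, hB, rfl⟩ := h
  obtain ⟨φ', A', B', hp', hv', hB', rfl⟩ := h'
  obtain ⟨-, rfl⟩ := potentials_unique hκ s hp hp' (hv.symm.trans hv')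
  rw [hB.eq hB']

theorem exists_isCurlOfPotential (κ c : ℝ) (s : Set.Ioo (0 : ℝ) 1) {r : ℝ} {v : TwoPt}
    (hv : v ∈ Hfhd κ s r) : ∃ w, IsCurlOfPotential κ c s r v w := by
  obtain ⟨φ, A, hp, hv⟩ := hv
  obtain ⟨B, hB⟩ := exists_hasPiCurl κ c s hp.memSobolev_vector
  exact ⟨_, φ, A, B, hp, hv, hB, rfl⟩

theorem IsCurlOfPotential.add {κ c : ℝ} {s : Set.Ioo (0 : ℝ) 1} {r : ℝ} {v w v' w' : TwoPt}
    (h : IsCurlOfPotential κ c s r v w) (h' : IsCurlOfPotential κ c s r v' w') :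
    IsCurlOfPotential κ c s r (v + v') (w + w') := by
  obtain ⟨φ, A, B, hp, rfl, hB, rfl⟩ := h
  obtain ⟨φ', A', B', hp', rfl, hB', rfl⟩ := h'
  exact ⟨φ + φ', A + A', B + B', hp.add hp', by rw [map_add, map_add, add_add_add_comm],
    hB.add hB', (map_add _ _ _).symm⟩

theorem IsCurlOfPotential.smul {κ c : ℝ} {s : Set.Ioo (0 : ℝ) 1} {r : ℝ} {v w : TwoPt}
    (h : IsCurlOfPotential κ c s r v w) (a : ℂ) :
    IsCurlOfPotential κ c s r (a • v) (a • w) := by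
  obtain ⟨φ, A, B, hp, rfl, hB, rfl⟩ := h
  exact ⟨a • φ, a • A, a • B, hp.smul a, by
    rw [map_smul, map_smul]; exact DistribSMul.smul_add a _ _, hB.smul a, (map_smul _ _ _).symm⟩

/-- The curl symbol discards the gradient part of `Πv`. Comparing densities, injectivity of `Π`
leaves any solution with no gradient part and with `Π𝒞*A` as its curl potential; conversely that
potential is admissible. -/
theorem hasTwoPtCurl_iff {κ c : ℝ} (hκ : 0 < κ) (hc : c ≠ 0) {s : Set.Ioo (0 : ℝ) 1} {r : ℝ}
    {v w : TwoPt} : HasTwoPtCurl κ c s r v w ↔ IsCurlOfPotential κ c s r v w := by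
  have hrs : r - s + (s : ℝ) = r := by ring
  have hrs' : r + s - (s : ℝ) = r := by ring
  constructor
  · rintro ⟨u, g, hu, hg, hw⟩
    obtain ⟨φ, A, Φ, G, hp, hv, hΦ, hG, huh⟩ := hasPi_iff.1 hu
    obtain ⟨U, hU, hgh⟩ := hasPiCurl_iff.1 hg
    obtain ⟨φ', A', Φ', G', hp', hw', hΦ', hG', hgh'⟩ := hasPi_iff.1 hw
    obtain rfl := hU.unique huh
    rw [map_add, mulOp_rotL_gradL, zero_add] at hgh
    obtain ⟨hΦ0, hGG⟩ := eq_of_mulOp_eq hκ hc s ((isDivFree_iff hG').1 hp'.divFree)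
      (mulOp_rotL_divFree hκ c s G) (hgh'.unique hgh)
    rw [hΦ0] at hΦ'
    obtain rfl := hΦ'.ext (hasHat_zero _)
    refine ⟨φ, A, A', hp, hv, hasPiCurl_iff.2 ⟨G, hG, ?_⟩, ?_⟩
    · rwa [hrs', ← hGG, ← hrs]
    · rw [hw', map_zero, zero_add]
  · rintro ⟨φ, A, B, hp, hv, hB, hw⟩
    have hpB := hB.isPotentials hκ
    obtain ⟨G, hG, hBh⟩ := hasPiCurl_iff.1 hB
    obtain ⟨Φ, hΦ⟩ := memSobolev_iff_hasHat.1 hp.memSobolev_scalar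
    obtain ⟨u, hu⟩ := exists_hasHat r (mulOp κ s (gradL c) Φ + mulOp κ s (rotL c) G)
    obtain ⟨g, hg⟩ := exists_hasHat (r - s) (mulOp κ s (rotL c) (mulOp κ s (rotL c) G))
    refine ⟨u, g, hasPi_iff.2 ⟨φ, A, Φ, G, hp, hv, hΦ, hG, hu⟩,
      hasPiCurl_iff.2 ⟨_, hu, by rwa [map_add, mulOp_rotL_gradL, zero_add]⟩,
      hasPi_iff.2 ⟨0, B, 0, mulOp κ s (rotL c) G, ?_, ?_, hasHat_zero _, ?_, ?_⟩⟩
    · rwa [hrs, ← hrs']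
    · rw [hw, map_zero, zero_add]
    · rwa [hrs, ← hrs']
    · rwa [map_zero, zero_add]

/-- `HasDiv` allows any representation of the field; uniqueness of potentials forces the scalar one
to be zero, and the divergence is a multiplier applied to it. -/
theorem hasDiv_cstar_iff {κ : ℝ} (hκ : 0 < κ) {s : Set.Ioo (0 : ℝ) 1} {r : ℝ} {B : 𝓢'(Pt, Vec)}
    (hB : IsPotentials (r + s) 0 B) {g : 𝓢'(Pt, ℂ)} : HasDiv κ s r (Cstar κ s B) g ↔ g = 0 := by
  constructor
  · intro h
    obtain ⟨φ, A, Φ, hp, hv, hΦ, hg⟩ := h.exists_hasHat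
    obtain ⟨rfl, -⟩ := potentials_unique hκ s hB hp (by rw [← hv, map_zero, zero_add])
    rw [hΦ.unique (hasHat_zero _), map_zero] at hg
    exact hg.ext (hasHat_zero _)
  · rintro rfl
    exact hasDiv_cstar_zero hB

/-- Values are chosen arbitrarily; linearity is automatic, since the relation respects sums and
multiples and determines its value. -/
theorem exists_twoPtCurl {κ : ℝ} (hκ : 0 < κ) (c : ℝ) (s : Set.Ioo (0 : ℝ) 1) (r : ℝ) :
    ∃ Ct : Hfhd κ s r →ₗ[ℂ] Hfhd κ s (r - s), ∀ v : Hfhd κ s r, IsCurlOfPotential κ c s r v (Ct v) := by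
  choose C hC using fun v : Hfhd κ s r => exists_isCurlOfPotential κ c s v.2
  exact ⟨{
    toFun := fun v => ⟨C v, (hC v).mem hκ⟩
    map_add' := fun v v' => Subtype.ext ((hC (v + v')).eq hκ ((hC v).add (hC v')))
    map_smul' := fun a v => Subtype.ext ((hC (a • v)).eq hκ ((hC v).smul a)) }, hC⟩

end FracCurl

theorem mainTheorem9 (κ c : ℝ) (hκ : 0 < κ) (hc : c ≠ 0) (s : Set.Ioo (0 : ℝ) 1) (r : ℝ) :
    ∃ Ct : Hfhd κ s r →ₗ[ℂ] Hfhd κ s (r - s),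
      (∀ (v : Hfhd κ s r) (w : TwoPt), HasTwoPtCurl κ c s r v w ↔ w = Ct v) ∧
      (∀ (φ : 𝓢'(Pt, ℂ)) (A : 𝓢'(Pt, Vec)) (v : Hfhd κ s r), IsPotentials (r + s) φ A →
        (v : TwoPt) = Dstar κ s φ + Cstar κ s A →
          ∃ B : 𝓢'(Pt, Vec), (∀ B', HasPiCurl κ c s (r + s) A B' ↔ B' = B) ∧
            (Ct v : TwoPt) = Cstar κ s B) ∧
      (∀ (v : Hfhd κ s r) (g : 𝓢'(Pt, ℂ)), HasDiv κ s (r - s) (Ct v) g ↔ g = 0) := by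
  obtain ⟨Ct, hCt⟩ := exists_twoPtCurl hκ c s r
  refine ⟨Ct, fun v w => ?_, fun φ A v hp hv => ?_, fun v g => ?_⟩
  · rw [hasTwoPtCurl_iff hκ hc]
    exact ⟨fun h => h.eq hκ (hCt v), fun h => h ▸ hCt v⟩
  · obtain ⟨B, hB⟩ := exists_hasPiCurl κ c s hp.memSobolev_vector
    exact ⟨B, fun B' => ⟨fun h => h.eq hB, fun h => h ▸ hB⟩,
      (hCt v).eq hκ ⟨φ, A, B, hp, hv, hB, rfl⟩⟩
  · obtain ⟨B, hB, hw⟩ := (hCt v).exists_isPotentials hκ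
    rw [hw]
    exact hasDiv_cstar_iff hκ hB
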